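/- Let $[N]=\{0,\dots,N-1\}$ with $N\ge 1$ and let $T\ge 1$ be an integer. For a probability distribution $D$ on $[N]$ and $S\subseteq[N]$ put $D(S)=\sum_{i\in S}D(i)$, and if $D(S)>0$ let $D_S$ be the conditional distribution: $D_S(i)=D(i)/D(S)$ for $i\in S$ and $D_S(i)=0$ for $i\notin S$. Say that $O_D:\mathcal P([N])\times[T]\to[N]$ represents $D$ if $D_S(i)=|\{t\in[T]:O_D(S,t)=i\}|/T$ for all $i\in[N]$ and all $S\subseteq[N]$ with $D(S)>0$. A query to the quantum conditional sampling oracle $\mathsf{QCOND}_D$ applies the unitary $$U_D|S\rangle|t\rangle|\beta\rangle=|S\rangle|t\rangle|\beta+O_D(S,t)\bmod N\rangle ,$$ acting as the identity on any workspace. A quantum algorithm making exactly $M$ queries prepares a fixed basis state, applies $V_0,U_D,V_1,U_D,\dots,U_D,V_M$ with unitaries $V_0,\dots,V_M$ that do not depend on $D$ or $O_D$ (and a finite-dimensional workspace), measures in the computational basis, and outputs a real number computed from the measurement outcome. **Theorem.** There is an absolute constant $c>0$ such that for all $N,T\ge1$, all $R\subseteq S\subseteq[N]$, all integers $M\ge0$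 and all $\delta\in(0,1]$ there is a quantum algorithm making exactly $M$ queries with the following property. For every probability distribution $D$ on $[N]$ with $D(S)>0$ and every $O_D$ representing $D$, the output $\tilde D_S(R)$ of the algorithm run with $\mathsf{QCOND}_D$ satisfies $$\mathbb P\bigl[\,|\tilde D_S(R)-D_S(R)|\le\epsilon\,\bigr]\ge 1-\delta$$ for every $\epsilon>0$ such that $$M\ \ge\ c\,\log(1/\delta)\,\max\!\left(\frac{\sqrt{D_S(R)}}{\epsilon},\frac1{\sqrt\epsilon}\right).$$ -/

import Mathlib

namespace QCond

/-- The weight `D(S) = ∑_{i ∈ S} D(i)` of a set `S ⊆ [N]`. -/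
noncomputable def weight {N : ℕ} (D : Fin N → ℝ) (S : Finset (Fin N)) : ℝ :=
  ∑ i ∈ S, D i

/-- The conditional distribution `D_S` (meaningful when `D(S) > 0`). -/
noncomputable def condDist {N : ℕ} (D : Fin N → ℝ) (S : Finset (Fin N)) (i : Fin N) : ℝ :=
  if i ∈ S then D i / weight D S else 0

/-- `O : P([N]) × [T] → [N]` represents the conditional distributions of `D`: whenever
`D(S) > 0`, the label `i` is attained by `O(S, ·)` with frequency exactly `D_S(i)`.
Nothing is required of `O(S, ·)` when `D(S) = 0`. -/
def Represents {N T : ℕ} (D : Fin N → ℝ) (O : Finset (Fin N) → Fin T → Fin N) : Prop :=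
  ∀ S : Finset (Fin N), 0 < weight D S →
    ∀ i : Fin N, condDist D S i = ((Finset.univ.filter fun t => O S t = i).card : ℝ) / (T : ℝ)

/-- Labels of the computational basis: the query set register, the `[T]` register, the `[N]`
output register, and a workspace of dimension `W` on which the oracle acts trivially. -/
abbrev Label (N T W : ℕ) : Type :=
  Finset (Fin N) × Fin T × Fin N × Fin W

/-- The quantum conditional sampling oracle
`|S⟩|t⟩|β⟩|w⟩ ↦ |S⟩|t⟩|β + O(S, t) mod N⟩|w⟩`
(column `b` of the matrix is the image of the basis state `b`). -/
def oracleMatrix {N T : ℕ} (W : ℕ) (O : Finset (Fin N) → Fin T → Fin N) :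
    Matrix (Label N T W) (Label N T W) ℂ :=
  Matrix.of fun b' b =>
    if b' = (b.1, b.2.1, b.2.2.1 + O b.1 b.2.1, b.2.2.2) then 1 else 0

/-- A quantum algorithm making exactly `M` oracle queries: a basis state is prepared, the fixed
unitaries `gate 0, …, gate M` are applied with one query between any two consecutive ones, all
registers are measured in the computational basis, and a real number is computed from the
measured label. -/
structure QueryAlgorithm (N T M : ℕ) where
  /-- Dimension of the workspace. -/
  workDim : ℕ
  /-- Label of the initial basis state. -/
  start : Label N T workDim
  /-- The unitaries that do not depend on the oracle. -/
  gate : Fin (M + 1) → Matrix.unitaryGroup (Label N T workDim) ℂ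
  /-- Classical post-processing of the measured label. -/
  output : Label N T workDim → ℝ

/-- The state vector after `k` queries, `gate k` having been applied. -/
noncomputable def QueryAlgorithm.state {N T M : ℕ} (A : QueryAlgorithm N T M)
    (O : Finset (Fin N) → Fin T → Fin N) (k : Fin (M + 1)) : Label N T A.workDim → ℂ :=
  Fin.induction (motive := fun _ => Label N T A.workDim → ℂ)
    (Matrix.mulVec (A.gate 0 : Matrix _ _ ℂ) (Pi.single A.start 1))
    (fun j ψ => Matrix.mulVec (A.gate j.succ : Matrix _ _ ℂ)
      (Matrix.mulVec (oracleMatrix A.workDim O) ψ)) k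

open Classical in
/-- The probability (Born rule) that the number output by `A`, run with oracle `O`, lies in
`E`. -/
noncomputable def QueryAlgorithm.prob {N T M : ℕ} (A : QueryAlgorithm N T M)
    (O : Finset (Fin N) → Fin T → Fin N) (E : Set ℝ) : ℝ :=
  ∑ b : Label N T A.workDim, if A.output b ∈ E then ‖A.state O (Fin.last M) b‖ ^ 2 else 0

end QCond

/-! Write D_S(R) = sin² θ. The times t with O(S,t) ∈ R form a fraction sin² θ of [T], so the task is
amplitude estimation for a Grover operator with eigenphases ±2θ. A workspace in superposition ∑ w_j
|j⟩ controls the number j of Grover iterations; an inverse Fourier transform turns it into an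
outcome y, and sin²(πy/Q) is output. An iteration costs two queries, so w may live on j ≤ M/2. The
law of y is the equal mixture of the distributions `kernel w / Q` centred at θ and at -θ
(`exists_amplitude_estimation`).

The factor log(1/δ) comes from the choice of w, not from a median of repetitions. Unless δ is close
to 1, w is proportional to the coefficients of (1 + X + ⋯ + X^(m-1))^r with r = ⌈log(1/δ)⌉ + 1 and m
of order M/r. Outcomes whose angle error has sine above 4/m then have total probability at most
r/16^(r-1) ≤ δ (`sum_kernel_powerWindow_far_le`).

For δ close to 1, log(1/δ) is small and the permitted error may lie below the resolution 1/m. But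
then only probability 1 - δ ≤ log(1/δ) is needed, and the flat window, with density of order m near
θ, gives this to an interval of length of order log(1/δ)/m (`le_sum_of_near`).

In both cases an error σ in the sine of the angle difference costs at most 2σ sin θ + σ² in the
output, and the query bound makes this at most ε (`error_le_of_query_bound`). -/

namespace QCond

open Matrix

/-! ### Unitary building blocks: monomial, reflection, controlled and Fourier matrices. -/

section Unitaries

variable {ι α κ : Type*} [Fintype ι] [DecidableEq ι] [Fintype α] [DecidableEq α]
  [Fintype κ] [DecidableEq κ]

/-- The matrix permuting the basis by `π` and multiplying the basis state `b` by `d b`. -/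
def monomialMatrix (π : Equiv.Perm ι) (d : ι → ℂ) : Matrix ι ι ℂ :=
  Matrix.of fun b' b => if b' = π b then d b else 0

theorem monomialMatrix_mulVec (π : Equiv.Perm ι) (d v : ι → ℂ) (b : ι) :
    (monomialMatrix π d *ᵥ v) b = d (π.symm b) * v (π.symm b) := by
  simp only [monomialMatrix, mulVec, dotProduct, Matrix.of_apply]
  rw [Finset.sum_eq_single (π.symm b)]
  · simp
  · intro c _ hc
    rw [if_neg, zero_mul]
    rintro rfl
    simp at hc
  · simp

theorem monomialMatrix_mem_unitaryGroup (π : Equiv.Perm ι) (d : ι → ℂ) (hd : ∀ b, ‖d b‖ = 1) :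
    monomialMatrix π d ∈ unitaryGroup ι ℂ := by
  rw [mem_unitaryGroup_iff']
  ext a b
  simp only [monomialMatrix, mul_apply, star_apply, Matrix.of_apply, one_apply]
  rw [Finset.sum_eq_single (π a)]
  · by_cases h : a = b
    · subst h
      have := Complex.conj_mul' (d a)
      simp [this, hd a]
    · simp [h]
  · intro c _ hc
    simp [hc]
  · simp

/-- The Householder reflection along `z` (the identity when `z = 0`). -/
noncomputable def reflectionMatrix (z : ι → ℂ) : Matrix ι ι ℂ :=
  1 - (2 / (star z ⬝ᵥ z)) • vecMulVec z (star z)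

theorem reflectionMatrix_mulVec (z v : ι → ℂ) :
    reflectionMatrix z *ᵥ v = v - (2 / (star z ⬝ᵥ z) * (star z ⬝ᵥ v)) • z := by
  rw [reflectionMatrix, sub_mulVec, one_mulVec, smul_mulVec, vecMulVec_mulVec]
  ext i
  simp
  ring

theorem reflectionMatrix_mem_unitaryGroup (z : ι → ℂ) :
    reflectionMatrix z ∈ unitaryGroup ι ℂ := by
  have hc : star (star z ⬝ᵥ z) = star z ⬝ᵥ z := by
    rw [← star_dotProduct_star, star_star]
  have hstar : star (reflectionMatrix z) = reflectionMatrix z := by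
    rw [reflectionMatrix, star_sub, star_one, star_smul, star_div₀, hc, star_eq_conjTranspose,
      conjTranspose_vecMulVec, star_star]
    norm_num
  rw [mem_unitaryGroup_iff', hstar]
  have hP : vecMulVec z (star z) * vecMulVec z (star z)
      = (star z ⬝ᵥ z) • vecMulVec z (star z) := by
    rw [vecMulVec_mul_vecMulVec]
    ext i j
    simp [vecMulVec_apply]
    ring
  rw [reflectionMatrix]
  generalize star z ⬝ᵥ z = c at *
  rw [sub_mul, mul_sub, mul_sub, one_mul, one_mul, mul_one, smul_mul_smul_comm, hP, smul_smul]
  by_cases h : c = 0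
  · simp [h]
  · have : 2 / c * (2 / c) * c = 2 / c + 2 / c := by field_simp; ring
    rw [this, add_smul]
    abel

open scoped ComplexOrder in
/-- Every real unit vector is the image of a given basis state under some unitary. -/
theorem exists_unitary_mulVec_single (b : ι) (v : ι → ℝ) (hv : ∑ i, v i ^ 2 = 1) :
    ∃ U : unitaryGroup ι ℂ,
      (U : Matrix ι ι ℂ) *ᵥ (Pi.single b 1) = fun i => (v i : ℂ) := by
  set w : ι → ℂ := fun i => (v i : ℂ) with hw
  set z : ι → ℂ := Pi.single b 1 - w with hz
  refine ⟨⟨reflectionMatrix z, reflectionMatrix_mem_unitaryGroup z⟩, ?_⟩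
  have hww : star w ⬝ᵥ w = 1 := by
    have : star w ⬝ᵥ w = ((∑ i, v i ^ 2 : ℝ) : ℂ) := by
      simp [dotProduct, hw, pow_two]
    rw [this, hv, Complex.ofReal_one]
  have hstar : star z = Pi.single b 1 - star w := by
    rw [hz, star_sub]
    congr 1
    ext i
    by_cases h : i = b
    · subst h; simp
    · simp [h]
  have hwb : star w b = (v b : ℂ) := by simp [hw]
  have h1 : star z ⬝ᵥ (Pi.single b 1) = 1 - (v b : ℂ) := by
    rw [dotProduct_single, mul_one, hstar, Pi.sub_apply, hwb]
    simp
  have h2 : star z ⬝ᵥ z = 2 * (1 - (v b : ℂ)) := by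
    conv_lhs => rw [hz]
    rw [← hz, dotProduct_sub, h1, hstar, sub_dotProduct, hww, single_dotProduct, one_mul]
    simp only [hw]
    ring
  change reflectionMatrix z *ᵥ _ = w
  rw [reflectionMatrix_mulVec, h1, h2]
  -- By `h2` this quantity vanishes only if z = 0, that is, if v is already the basis state.
  by_cases h : (1 - (v b : ℂ)) = 0
  · have hz0 : z = 0 := dotProduct_star_self_eq_zero.mp (by rw [h2, h, mul_zero])
    rw [hz0, smul_zero, sub_zero]
    rw [hz, sub_eq_zero] at hz0
    exact hz0
  · have : 2 / (2 * (1 - (v b : ℂ))) * (1 - (v b : ℂ)) = 1 := by field_simp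
    rw [this, one_smul, hz, sub_sub_cancel]

/-- A family of matrices acting on the factor `α` of a register, controlled by the factor `κ`. -/
def controlled (e : ι ≃ α × κ) (A : κ → Matrix α α ℂ) : Matrix ι ι ℂ :=
  (blockDiagonal A).submatrix e e

omit [DecidableEq ι] [DecidableEq α] in
theorem controlled_mulVec (e : ι ≃ α × κ) (A : κ → Matrix α α ℂ) (v : ι → ℂ) (i : ι) :
    (controlled e A *ᵥ v) i = ∑ a, A (e i).2 (e i).1 a * v (e.symm (a, (e i).2)) := by
  rw [controlled, submatrix_mulVec_equiv]
  simp only [Function.comp_apply, mulVec, dotProduct, Fintype.sum_prod_type, blockDiagonal_apply]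
  refine Finset.sum_congr rfl fun a _ => ?_
  simp

theorem controlled_mem_unitaryGroup (e : ι ≃ α × κ) (A : κ → Matrix α α ℂ)
    (hA : ∀ k, A k ∈ unitaryGroup α ℂ) : controlled e A ∈ unitaryGroup ι ℂ := by
  rw [mem_unitaryGroup_iff', controlled, star_eq_conjTranspose, conjTranspose_submatrix,
    submatrix_mul_equiv, blockDiagonal_conjTranspose, ← blockDiagonal_mul]
  have : (fun k => (A k)ᴴ * A k) = 1 := by
    funext k
    exact mem_unitaryGroup_iff'.mp (hA k)
  rw [this, blockDiagonal_one, submatrix_one_equiv]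

/-- The sum of squared moduli is preserved by unitary matrices. -/
theorem sum_norm_sq_mulVec (U : Matrix ι ι ℂ) (hU : U ∈ unitaryGroup ι ℂ) (v : ι → ℂ) :
    ∑ i, ‖(U *ᵥ v) i‖ ^ 2 = ∑ i, ‖v i‖ ^ 2 := by
  have key : ∀ u : ι → ℂ, ((∑ i, ‖u i‖ ^ 2 : ℝ) : ℂ) = star u ⬝ᵥ u := by
    intro u
    simp [dotProduct, Complex.conj_mul']
  apply Complex.ofReal_injective
  rw [key, key, star_mulVec, dotProduct_mulVec, vecMul_vecMul, ← star_eq_conjTranspose,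
    mem_unitaryGroup_iff'.mp hU, vecMul_one]

/-- The inverse quantum Fourier transform on `Fin Q`. -/
noncomputable def fourierMatrix (Q : ℕ) : Matrix (Fin Q) (Fin Q) ℂ :=
  Matrix.of fun y j =>
    Complex.exp (-(2 * Real.pi * (y : ℕ) * (j : ℕ) / Q : ℝ) * Complex.I) / (Real.sqrt Q : ℝ)

/-- The Gram entries are geometric sums in ζ = ω^a / ω^b, a Q-th root of unity different from 1 off
the diagonal. -/
theorem fourierMatrix_mem_unitaryGroup (Q : ℕ) : fourierMatrix Q ∈ unitaryGroup (Fin Q) ℂ := by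
  rcases Nat.eq_zero_or_pos Q with rfl | hQ
  · rw [mem_unitaryGroup_iff']
    exact Subsingleton.elim _ _
  have hQ0 : (Q : ℂ) ≠ 0 := by exact_mod_cast hQ.ne'
  rw [mem_unitaryGroup_iff']
  ext a b
  set ω : ℂ := Complex.exp (2 * Real.pi * Complex.I / Q) with hω
  have hprim : IsPrimitiveRoot ω Q := Complex.isPrimitiveRoot_exp Q hQ.ne'
  have hω0 : ω ≠ 0 := Complex.exp_ne_zero _
  set ζ : ℂ := ω ^ (a : ℕ) / ω ^ (b : ℕ) with hζ
  have hsq : (Real.sqrt Q : ℂ) * (Real.sqrt Q : ℂ) = Q := by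
    rw [← Complex.ofReal_mul, Real.mul_self_sqrt (Nat.cast_nonneg _), Complex.ofReal_natCast]
  have hentry : ∀ y : Fin Q,
      star (fourierMatrix Q) a y * fourierMatrix Q y b = ζ ^ (y : ℕ) / Q := by
    intro y
    simp only [star_apply, fourierMatrix, Matrix.of_apply, RCLike.star_def, map_div₀,
      ← Complex.exp_conj, map_mul, map_neg, Complex.conj_ofReal, Complex.conj_I]
    rw [div_mul_div_comm, hsq, ← Complex.exp_add, hζ, hω, ← Complex.exp_nat_mul,
      ← Complex.exp_nat_mul, ← Complex.exp_sub, ← Complex.exp_nat_mul]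
    congr 2
    push_cast
    field_simp
    ring
  rw [mul_apply, Finset.sum_congr rfl fun y _ => hentry y, ← Finset.sum_div,
    Fin.sum_univ_eq_sum_range (fun i => ζ ^ i), one_apply]
  split_ifs with h
  · subst h
    have : ζ = 1 := div_self (pow_ne_zero _ hω0)
    simp [this, hQ0]
  · have hne : ζ ≠ 1 := by
      intro h1
      rw [hζ, div_eq_one_iff_eq (pow_ne_zero _ hω0)] at h1
      exact h (Fin.ext (hprim.pow_inj a.2 b.2 h1))
    have hpow : ζ ^ Q = 1 := by
      rw [hζ, div_pow, ← pow_mul, ← pow_mul, mul_comm, pow_mul, mul_comm, pow_mul,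
        hprim.pow_eq_one, one_pow, one_pow, div_one]
    rw [geom_sum_eq hne, hpow, sub_self, zero_div, zero_div]

end Unitaries

/-! ### Coherently controlled Grover iteration as a query algorithm. -/

section Algorithm

variable {N T W : ℕ}

/-- The state in which the query register holds `S`, the output register holds `β t` and the
remaining registers are in the state `g`. -/
def encode (S : Finset (Fin N)) (β : Fin T → Fin N) (g : Fin T → Fin W → ℂ) :
    Label N T W → ℂ :=
  fun b => if b.1 = S ∧ b.2.2.1 = β b.2.1 then g b.2.1 b.2.2.2 else 0

/-- Knowing π on the support is enough: that support already fills the target support, so by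
injectivity no other label is sent there. -/
theorem monomialMatrix_mulVec_encode (π : Equiv.Perm (Label N T W)) (d : Label N T W → ℂ)
    (S : Finset (Fin N)) (β β' : Fin T → Fin N) (g : Fin T → Fin W → ℂ)
    (h : ∀ t w, π (S, t, β t, w) = (S, t, β' t, w)) :
    monomialMatrix π d *ᵥ encode S β g
      = encode S β' (fun t w => d (S, t, β t, w) * g t w) := by
  ext b
  obtain ⟨c, rfl⟩ := π.surjective b
  rw [monomialMatrix_mulVec, Equiv.symm_apply_apply]
  obtain ⟨S₁, t, x, w⟩ := c
  by_cases hc : S₁ = S ∧ x = β t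
  · obtain ⟨rfl, rfl⟩ := hc
    simp [encode, h]
  · have hc' : ¬ ((π (S₁, t, x, w)).1 = S ∧
        (π (S₁, t, x, w)).2.2.1 = β' (π (S₁, t, x, w)).2.1) := by
      rintro ⟨h1, h2⟩
      have := h (π (S₁, t, x, w)).2.1 (π (S₁, t, x, w)).2.2.2
      rw [← h2, ← h1] at this
      have := π.injective this
      simp only [Prod.mk.injEq] at this
      refine hc ⟨this.1.symm.trans h1, ?_⟩
      rw [← this.2.2.1, this.2.1]
    simp only [encode, hc, hc', if_false, mul_zero]

/-- The oracle as a permutation of the labels. -/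
def oraclePerm [NeZero N] (W : ℕ) (O : Finset (Fin N) → Fin T → Fin N) :
    Equiv.Perm (Label N T W) where
  toFun b := (b.1, b.2.1, b.2.2.1 + O b.1 b.2.1, b.2.2.2)
  invFun b := (b.1, b.2.1, b.2.2.1 - O b.1 b.2.1, b.2.2.2)
  left_inv b := by simp
  right_inv b := by simp

theorem oracleMatrix_eq_monomialMatrix [NeZero N] (O : Finset (Fin N) → Fin T → Fin N) :
    oracleMatrix W O = monomialMatrix (oraclePerm W O) fun _ => 1 := rfl

/-- Negation of the output register. -/
def negPerm [NeZero N] : Equiv.Perm (Label N T W) where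
  toFun b := (b.1, b.2.1, -b.2.2.1, b.2.2.2)
  invFun b := (b.1, b.2.1, -b.2.2.1, b.2.2.2)
  left_inv b := by simp
  right_inv b := by simp

/-- Separation of the `[T]` register. -/
def timeEquiv : Label N T W ≃ Fin T × (Finset (Fin N) × Fin N × Fin W) where
  toFun b := (b.2.1, (b.1, b.2.2.1, b.2.2.2))
  invFun b := (b.2.1, b.1, b.2.2.1, b.2.2.2)
  left_inv _ := rfl
  right_inv _ := rfl

/-- Separation of the workspace. -/
def workEquiv : Label N T W ≃ Fin W × (Finset (Fin N) × Fin T × Fin N) where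
  toFun b := (b.2.2.2, (b.1, b.2.1, b.2.2.1))
  invFun b := (b.2.1, b.2.2.1, b.2.2.2, b.1)
  left_inv _ := rfl
  right_inv _ := rfl

theorem controlled_timeEquiv_mulVec_encode
    (A : Finset (Fin N) × Fin N × Fin W → Matrix (Fin T) (Fin T) ℂ)
    (S : Finset (Fin N)) (x : Fin N) (g : Fin T → Fin W → ℂ) :
    controlled timeEquiv A *ᵥ encode S (fun _ => x) g
      = encode S (fun _ => x) (fun t w => (A (S, x, w) *ᵥ fun t' => g t' w) t) := by
  ext ⟨S₁, t, y, w⟩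
  rw [controlled_mulVec]
  by_cases hc : S₁ = S ∧ y = x
  · obtain ⟨rfl, rfl⟩ := hc
    simp [encode, timeEquiv, mulVec, dotProduct]
  · simp [encode, timeEquiv, hc]

theorem controlled_workEquiv_mulVec_encode (A : Matrix (Fin W) (Fin W) ℂ)
    (S : Finset (Fin N)) (β : Fin T → Fin N) (g : Fin T → Fin W → ℂ) :
    controlled workEquiv (fun _ => A) *ᵥ encode S β g
      = encode S β (fun t w => (A *ᵥ g t) w) := by
  ext ⟨S₁, t, y, w⟩
  rw [controlled_mulVec]
  by_cases hc : S₁ = S ∧ y = β t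
  · obtain ⟨rfl, rfl⟩ := hc
    simp [encode, workEquiv, mulVec, dotProduct]
  · simp [encode, workEquiv, hc]

/-- The iterates of the Grover operator with phases `σ`, started in the uniform superposition. -/
noncomputable def grover (σ : Fin T → ℂ) : ℕ → Fin T → ℂ
  | 0, _ => (1 / Real.sqrt T : ℝ)
  | i + 1, t => 2 / T * ∑ t', σ t' * grover σ i t' - σ t * grover σ i t

/-- The phase `-1` on the times at which the oracle answers an element of `R`. -/
noncomputable def markPhase (O : Finset (Fin N) → Fin T → Fin N) (S R : Finset (Fin N))
    (t : Fin T) : ℂ :=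
  if O S t ∈ R then -1 else 1

/-- Flips the phase when the output register lies in `R` and the workspace exceeds `i`, and
negates the output register. -/
noncomputable def phaseGate [NeZero N] (T W : ℕ) (R : Finset (Fin N)) (i : ℕ) :
    unitaryGroup (Label N T W) ℂ :=
  ⟨monomialMatrix negPerm fun b => if b.2.2.1 ∈ R ∧ i < b.2.2.2 then -1 else 1,
    monomialMatrix_mem_unitaryGroup _ _ fun b => by split_ifs <;> simp⟩

/-- Inversion about the mean of the `[T]` register when the workspace exceeds `i`. -/
noncomputable def diffusionGate (N T W : ℕ) (i : ℕ) : unitaryGroup (Label N T W) ℂ :=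
  ⟨controlled timeEquiv fun k => if i < k.2.2 then -reflectionMatrix 1 else 1,
    controlled_mem_unitaryGroup _ _ fun k => by
      split_ifs
      · exact (-(⟨_, reflectionMatrix_mem_unitaryGroup 1⟩ : unitaryGroup (Fin T) ℂ)).2
      · exact one_mem _⟩

/-- The inverse Fourier transform on the workspace. -/
noncomputable def fourierGate (N T W : ℕ) : unitaryGroup (Label N T W) ℂ :=
  ⟨controlled workEquiv fun _ => fourierMatrix W,
    controlled_mem_unitaryGroup _ _ fun _ => fourierMatrix_mem_unitaryGroup W⟩

/-- The gates of coherently controlled Grover iteration, with state preparation `V`. -/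
noncomputable def groverGate [NeZero N] (R : Finset (Fin N)) (V : unitaryGroup (Label N T W) ℂ) :
    ℕ → unitaryGroup (Label N T W) ℂ
  | 0 => V
  | k + 1 => if Even k then phaseGate T W R (k / 2) else diffusionGate N T W (k / 2)

/-- The state after `k` queries of coherently controlled Grover iteration. -/
noncomputable def groverState [NeZero N] (O : Finset (Fin N) → Fin T → Fin N)
    (S R : Finset (Fin N)) (w : Fin W → ℝ) (k : ℕ) : Label N T W → ℂ :=
  if Even k then
    encode S (fun _ => 0) fun t j => w j * grover (markPhase O S R) (min (k / 2) j) t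
  else
    encode S (fun t => -O S t) fun t j => (if O S t ∈ R ∧ k / 2 < j then -1 else 1) *
      (w j * grover (markPhase O S R) (min (k / 2) j) t)

theorem neg_reflectionMatrix_one_mulVec (v : Fin T → ℂ) (t : Fin T) :
    (-reflectionMatrix 1 *ᵥ v) t = 2 / T * ∑ t', v t' - v t := by
  rw [neg_mulVec, reflectionMatrix_mulVec]
  simp [dotProduct]

/-- One iteration takes two queries. The first writes O(S,t) into the zero register; the phase gate
marks R and negates the register; the second query adds O(S,t) to -O(S,t), so it clears the register
without an inverse oracle. The control i < j freezes branch j after j iterations. -/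
theorem groverGate_succ_mulVec [NeZero N] (O : Finset (Fin N) → Fin T → Fin N)
    (S R : Finset (Fin N)) (w : Fin W → ℝ) (V : unitaryGroup (Label N T W) ℂ) (k : ℕ) :
    (groverGate R V (k + 1) : Matrix _ _ ℂ) *ᵥ (oracleMatrix W O *ᵥ groverState O S R w k)
      = groverState O S R w (k + 1) := by
  rw [oracleMatrix_eq_monomialMatrix]
  rcases Nat.even_or_odd' k with ⟨i, rfl | rfl⟩
  · have h1 : ¬ Even (2 * i + 1) := by simp
    have h2 : (2 * i + 1) / 2 = i := by omega
    have h3 : 2 * i / 2 = i := by omega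
    have h4 : Even (2 * i) := by simp
    simp only [groverGate, groverState, h1, h2, h3, h4, if_true, if_false, phaseGate]
    rw [monomialMatrix_mulVec_encode _ _ S _ (fun t => O S t), monomialMatrix_mulVec_encode _ _ S
      _ (fun t => -O S t)]
    · simp
    · intro t w; simp [negPerm]
    · intro t w; simp [oraclePerm]
  · have h1 : ¬ Even (2 * i + 1) := by simp
    have h2 : (2 * i + 1) / 2 = i := by omega
    have h3 : (2 * i + 1 + 1) / 2 = i + 1 := by omega
    have h4 : Even (2 * i + 1 + 1) := by simp [Nat.even_add_one]
    simp only [groverGate, groverState, h1, h2, h3, h4, if_true, if_false, diffusionGate]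
    rw [monomialMatrix_mulVec_encode _ _ S _ (fun _ => 0), controlled_timeEquiv_mulVec_encode]
    · congr 1
      ext t j
      by_cases hj : i < j
      · have e1 : min i (j : ℕ) = i := by omega
        have e2 : min (i + 1) (j : ℕ) = i + 1 := by omega
        simp only [hj, if_true, e1, e2, neg_reflectionMatrix_one_mulVec, grover, and_true,
          markPhase, one_mul]
        rw [mul_sub, Finset.mul_sum, Finset.mul_sum, Finset.mul_sum]
        congr 1
        · exact Finset.sum_congr rfl fun t' _ => by ring
        · ring
      · have e1 : min i (j : ℕ) = j := by omega
        have e2 : min (i + 1) (j : ℕ) = j := by omega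
        simp [hj, e1, e2]
    · intro t w; simp [oraclePerm]

/-- Every branch of nonzero amplitude has finished its iterations. For odd k the unpaired query
changes only β, since its phase acts on branches of amplitude zero. -/
theorem groverState_eq_encode [NeZero N] (O : Finset (Fin N) → Fin T → Fin N)
    (S R : Finset (Fin N)) (w : Fin W → ℝ) (k : ℕ) (hw : ∀ j : Fin W, k / 2 < j → w j = 0) :
    ∃ β : Fin T → Fin N, groverState O S R w k
      = encode S β fun t j => w j * grover (markPhase O S R) j t := by
  have key : ∀ (j : Fin W) t, (w j : ℂ) * grover (markPhase O S R) (min (k / 2) j) t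
      = w j * grover (markPhase O S R) j t := by
    intro j t
    by_cases hj : k / 2 < j
    · simp [hw j hj]
    · rw [min_eq_right (not_lt.mp hj)]
  unfold groverState
  split_ifs
  · exact ⟨fun _ => 0, by simp only [key]⟩
  · refine ⟨fun t => -O S t, ?_⟩
    congr 1
    ext t j
    rw [key]
    by_cases hj : k / 2 < j
    · simp [hw j hj]
    · simp [hj]

/-- The result does not involve β, so an oracle answer left in the output register does not affect
the statistics of the workspace. -/
theorem sum_norm_sq_encode_ite (S : Finset (Fin N)) (β : Fin T → Fin N) (g : Fin T → Fin W → ℂ)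
    (p : Fin W → Prop) [DecidablePred p] :
    (∑ b : Label N T W, if p b.2.2.2 then ‖encode S β g b‖ ^ 2 else 0)
      = ∑ y, if p y then ∑ t, ‖g t y‖ ^ 2 else 0 := by
  have h : ∀ (S₁ : Finset (Fin N)) t x y,
      (if p y then ‖encode S β g (S₁, t, x, y)‖ ^ 2 else 0)
        = if S₁ = S then if x = β t then if p y then ‖g t y‖ ^ 2 else 0 else 0 else 0 := by
    intro S₁ t x y
    simp only [encode]
    by_cases h1 : S₁ = S <;> by_cases h2 : x = β t <;> simp [h1, h2]
  simp only [Fintype.sum_prod_type, h]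
  simp only [Finset.sum_ite_irrel, Finset.sum_const_zero, Finset.sum_ite_eq',
    Finset.mem_univ, if_true]
  rw [Finset.sum_comm]
  refine Finset.sum_congr rfl fun y _ => ?_
  split_ifs <;> simp

/-- Coherently controlled Grover iteration with amplitudes `w` of the number of iterations,
followed by an inverse Fourier transform. -/
theorem exists_grover_algorithm (hN : 0 < N) (hT : 0 < T) (S R : Finset (Fin N)) (M Q : ℕ)
    (hQ : 0 < Q) (w : Fin Q → ℝ) (hw : ∑ j, w j ^ 2 = 1) (hsupp : ∀ j : Fin Q, M / 2 < j → w j = 0)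
    (out : Fin Q → ℝ) :
    ∃ A : QueryAlgorithm N T M, ∀ (O : Finset (Fin N) → Fin T → Fin N) (E : Set ℝ)
      [DecidablePred (· ∈ E)], A.prob O E = ∑ y, if out y ∈ E then
        ∑ t, ‖∑ j, fourierMatrix Q y j * (w j * grover (markPhase O S R) j t)‖ ^ 2 else 0 := by
  have : NeZero N := ⟨hN.ne'⟩
  have hT0 : (T : ℝ) ≠ 0 := by exact_mod_cast hT.ne'
  set v : Label N T Q → ℝ := fun b =>
    if b.1 = S ∧ b.2.2.1 = 0 then w b.2.2.2 * (1 / Real.sqrt T) else 0 with hv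
  have hvenc : (fun b => (v b : ℂ))
      = encode S (fun _ => 0) fun _ j => (w j : ℂ) * (1 / Real.sqrt T : ℝ) := by
    ext b
    simp only [hv, encode]
    split_ifs <;> push_cast <;> rfl
  have hunit : ∑ b, v b ^ 2 = 1 := by
    have h1 := sum_norm_sq_encode_ite S (fun _ : Fin T => (0 : Fin N))
      (fun _ j => (w j : ℂ) * (1 / Real.sqrt T : ℝ)) (fun _ => True)
    rw [← hvenc] at h1
    simp only [if_true, Complex.norm_real, Real.norm_eq_abs, sq_abs, ← Complex.ofReal_mul] at h1
    rw [h1]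
    simp only [Finset.sum_const, Finset.card_univ, Fintype.card_fin, nsmul_eq_mul, mul_pow,
      div_pow, one_pow, Real.sq_sqrt (Nat.cast_nonneg T)]
    exact (Finset.sum_congr rfl fun j _ => by field_simp).trans hw
  obtain ⟨V, hV⟩ := exists_unitary_mulVec_single
    ((S, ⟨0, hT⟩, 0, ⟨0, hQ⟩) : Label N T Q) v hunit
  let A : QueryAlgorithm N T M :=
    { workDim := Q
      start := (S, ⟨0, hT⟩, 0, ⟨0, hQ⟩)
      -- The Fourier transform is merged into the last gate, which for M = 0 is also the preparation
      -- gate.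
      gate := fun k => if k = Fin.last M then fourierGate N T Q * groverGate R V k
        else groverGate R V k
      output := fun b => out b.2.2.2 }
  refine ⟨A, fun O E _ => ?_⟩
  have hstate : ∀ k : Fin (M + 1), A.state O k = if k = Fin.last M then
      (fourierGate N T Q : Matrix _ _ ℂ) *ᵥ groverState O S R w k
      else groverState O S R w k := by
    intro k
    induction k using Fin.induction with
    | zero =>
      have h0 : (V : Matrix (Label N T Q) (Label N T Q) ℂ) *ᵥ (Pi.single A.start 1) = groverState O S R w 0 := by
        change (V : Matrix (Label N T Q) (Label N T Q) ℂ) *ᵥ (Pi.single ((S, ⟨0, hT⟩, 0, ⟨0, hQ⟩) : Label N T Q) 1) = _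
        rw [hV, hvenc]
        simp [groverState, grover]
      change ((if (0 : Fin (M + 1)) = Fin.last M then fourierGate N T Q * groverGate R V 0
        else groverGate R V 0 : unitaryGroup (Label N T Q) ℂ) :
          Matrix (Label N T Q) (Label N T Q) ℂ) *ᵥ _ = _
      split_ifs
      · rw [Submonoid.coe_mul, ← mulVec_mulVec]
        exact congrArg _ h0
      · exact h0
    | succ i ih =>
      rw [if_neg (Fin.castSucc_lt_last i).ne] at ih
      have hstep : A.state O i.succ = (A.gate i.succ : Matrix _ _ ℂ) *ᵥ
          (oracleMatrix Q O *ᵥ A.state O i.castSucc) := rfl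
      rw [hstep, ih]
      have h1 := groverGate_succ_mulVec O S R w V i
      change ((if i.succ = Fin.last M then fourierGate N T Q * groverGate R V (i + 1)
        else groverGate R V (i + 1) : unitaryGroup (Label N T Q) ℂ) :
          Matrix (Label N T Q) (Label N T Q) ℂ) *ᵥ _ = _
      split_ifs
      · rw [Submonoid.coe_mul, ← mulVec_mulVec]
        exact congrArg _ h1
      · exact h1
  obtain ⟨β, hβ⟩ := groverState_eq_encode O S R w M hsupp
  have hlast : A.state O (Fin.last M) = encode S β fun t y => (fourierMatrix Q *ᵥ
      fun j => w j * grover (markPhase O S R) j t) y := by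
    rw [hstate, if_pos rfl, Fin.val_last, hβ]
    exact controlled_workEquiv_mulVec_encode _ _ _ _
  rw [QueryAlgorithm.prob, hlast]
  convert sum_norm_sq_encode_ite S β (fun t y => (fourierMatrix Q *ᵥ
      fun j => w j * grover (markPhase O S R) j t) y) (fun y => out y ∈ E) using 1
  · exact Finset.sum_congr rfl fun b _ => by congr
  · rfl

end Algorithm

/-! ### Grover iteration as a plane rotation. -/

section GroverRotation

variable {N T : ℕ}

/-- Handles the degenerate angle at which a quotient by sin θ takes the default value 0: its
numerator vanishes too. -/
theorem sin_odd_mul_eq_zero {θ : ℝ} (h : Real.sin θ = 0) (j : ℕ) :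
    Real.sin ((2 * j + 1) * θ) = 0 := by
  obtain ⟨n, rfl⟩ := Real.sin_eq_zero_iff.mp h
  exact Real.sin_eq_zero_iff.mpr ⟨(2 * j + 1) * n, by push_cast; ring⟩

theorem cos_odd_mul_eq_zero {θ : ℝ} (h : Real.cos θ = 0) (j : ℕ) :
    Real.cos ((2 * j + 1) * θ) = 0 := by
  obtain ⟨n, rfl⟩ := Real.cos_eq_zero_iff.mp h
  exact Real.cos_eq_zero_iff.mpr ⟨2 * j * n + j + n, by push_cast; ring⟩

theorem sum_ite_sin_cos (p : Fin T → Prop) [DecidablePred p] (θ : ℝ)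
    (hθ : ((Finset.univ.filter p).card : ℝ) = T * Real.sin θ ^ 2) (a b : ℝ) :
    (∑ t, if p t then a else b) = T * (Real.sin θ ^ 2 * a + Real.cos θ ^ 2 * b) := by
  have h1 : ((Finset.univ.filter fun t => ¬ p t).card : ℝ) = T * Real.cos θ ^ 2 := by
    have h2 : (((Finset.univ.filter p).card + (Finset.univ.filter fun t => ¬ p t).card : ℕ) : ℝ)
        = T := by
      rw [Finset.card_filter_add_card_filter_not, Finset.card_univ, Fintype.card_fin]
    push_cast at h2
    rw [Real.cos_sq', mul_sub, ← hθ, ← h2]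
    ring
  rw [Finset.sum_ite, Finset.sum_const, Finset.sum_const, nsmul_eq_mul, nsmul_eq_mul, hθ, h1]
  ring

/-- Grover iteration is a rotation by the angle `2θ`, where `sin² θ` is the fraction of marked
elements. -/
theorem grover_eq (p : Fin T → Prop) [DecidablePred p] (θ : ℝ)
    (hθ : ((Finset.univ.filter p).card : ℝ) = T * Real.sin θ ^ 2) (i : ℕ) (t : Fin T) :
    grover (fun t => if p t then -1 else 1) i t = ((1 / Real.sqrt T *
      if p t then Real.sin ((2 * i + 1) * θ) / Real.sin θ
      else Real.cos ((2 * i + 1) * θ) / Real.cos θ : ℝ) : ℂ) := by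
  have hT : 0 < T := t.pos
  have hT0 : (0 : ℝ) < T := by exact_mod_cast hT
  -- A marked element forces sin θ ≠ 0, an unmarked one cos θ ≠ 0, so the quotient selected at t
  -- never has denominator zero.
  have hsin : ∀ t, p t → Real.sin θ ≠ 0 := by
    intro t ht h
    rw [h] at hθ
    norm_num at hθ
    exact hθ ht
  have hcos : ∀ t, ¬ p t → Real.cos θ ≠ 0 := by
    intro t ht h
    have h2 : ((Finset.univ.filter p).card : ℝ) = T := by
      rw [hθ, Real.sin_sq, h]; ring
    have h3 : (Finset.univ.filter p).card = (Finset.univ : Finset (Fin T)).card := by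
      rw [Finset.card_univ, Fintype.card_fin]
      exact_mod_cast h2
    exact ht (Finset.card_filter_eq_iff.mp h3 t (Finset.mem_univ t))
  induction i generalizing t with
  | zero =>
    simp only [grover, Nat.cast_zero, mul_zero, zero_add, one_mul]
    split_ifs with h
    · rw [div_self (hsin t h), mul_one]
    · rw [div_self (hcos t h), mul_one]
  | succ i ih =>
    have hsum : ∑ t', (if p t' then -1 else 1 : ℂ) * grover (fun t => if p t then -1 else 1) i t'
        = ((T * (1 / Real.sqrt T) * Real.cos ((2 * i + 2) * θ) : ℝ) : ℂ) := by
      have h1 : ∀ t', (if p t' then -1 else 1 : ℂ) *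
          grover (fun t => if p t then -1 else 1) i t' = ((if p t' then
            -(1 / Real.sqrt T * (Real.sin ((2 * i + 1) * θ) / Real.sin θ))
          else 1 / Real.sqrt T * (Real.cos ((2 * i + 1) * θ) / Real.cos θ) : ℝ) : ℂ) := by
        intro t'
        rw [ih t']
        split_ifs <;> push_cast <;> ring
      rw [Finset.sum_congr rfl fun t' _ => h1 t', ← Complex.ofReal_sum,
        sum_ite_sin_cos p θ hθ]
      congr 1
      have e1 : (2 * i + 2) * θ = (2 * i + 1) * θ + θ := by ring
      have hs : Real.sin θ ^ 2 * (Real.sin ((2 * i + 1) * θ) / Real.sin θ)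
          = Real.sin θ * Real.sin ((2 * i + 1) * θ) := by
        by_cases h : Real.sin θ = 0
        · simp [h]
        · field_simp
      have hc : Real.cos θ ^ 2 * (Real.cos ((2 * i + 1) * θ) / Real.cos θ)
          = Real.cos θ * Real.cos ((2 * i + 1) * θ) := by
        by_cases h : Real.cos θ = 0
        · simp [h]
        · field_simp
      rw [e1, Real.cos_add]
      linear_combination (T * (1 / Real.sqrt T)) * (hc - hs)
    rw [grover, hsum, ih t]
    have e1 : (2 * ((i + 1 : ℕ) : ℝ) + 1) * θ = (2 * i + 2) * θ + θ := by push_cast; ring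
    have e2 : (2 * i + 1) * θ = (2 * i + 2) * θ - θ := by ring
    rw [e1, e2]
    have hT' : (T : ℂ) ≠ 0 := by exact_mod_cast hT.ne'
    have key : (2 / T : ℂ) * ((T * (1 / Real.sqrt T) * Real.cos ((2 * i + 2) * θ) : ℝ) : ℂ)
        = ((1 / Real.sqrt T * (2 * Real.cos ((2 * i + 2) * θ)) : ℝ) : ℂ) := by
      push_cast
      field_simp
    rw [key]
    split_ifs with h
    · have := hsin t h
      rw [neg_one_mul, sub_neg_eq_add, ← Complex.ofReal_add, ← mul_add]
      congr 2
      rw [Real.sin_sub, Real.sin_add]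
      field_simp
      ring
    · have := hcos t h
      rw [one_mul, ← Complex.ofReal_sub, ← mul_sub]
      congr 2
      rw [Real.cos_sub, Real.cos_add]
      field_simp
      ring

/-- With A and B the sine and cosine sums, the marked and unmarked parts contribute ‖A‖² and ‖B‖².
The exponential sums at ±θ are B ± iA, so the parallelogram law turns ‖A‖² + ‖B‖² into an average
over the two eigenphases. -/
theorem sum_norm_sq_sum_grover (hT : 0 < T) (p : Fin T → Prop) [DecidablePred p] (θ : ℝ)
    (hθ : ((Finset.univ.filter p).card : ℝ) = T * Real.sin θ ^ 2) {Q : ℕ} (c : Fin Q → ℂ) :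
    ∑ t, ‖∑ j, c j * grover (fun t => if p t then -1 else 1) j t‖ ^ 2
      = (‖∑ j, c j * Complex.exp (((2 * (j : ℕ) + 1) * θ : ℝ) * Complex.I)‖ ^ 2
        + ‖∑ j, c j * Complex.exp (((2 * (j : ℕ) + 1) * -θ : ℝ) * Complex.I)‖ ^ 2) / 2 := by
  have hT0 : (0 : ℝ) < T := by exact_mod_cast hT
  set A : ℂ := ∑ j, c j * (Real.sin ((2 * (j : ℕ) + 1) * θ) : ℝ) with hA
  set B : ℂ := ∑ j, c j * (Real.cos ((2 * (j : ℕ) + 1) * θ) : ℝ) with hB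
  have h1 : ∀ t, ‖∑ j, c j * grover (fun t => if p t then -1 else 1) j t‖ ^ 2
      = if p t then 1 / T * (‖A‖ ^ 2 / Real.sin θ ^ 2)
        else 1 / T * (‖B‖ ^ 2 / Real.cos θ ^ 2) := by
    intro t
    have h2 : ∑ j, c j * grover (fun t => if p t then -1 else 1) j t = ((1 / Real.sqrt T : ℝ) : ℂ) *
        if p t then A / (Real.sin θ : ℝ) else B / (Real.cos θ : ℝ) := by
      simp only [grover_eq p θ hθ]
      split_ifs
      · rw [hA, Finset.sum_div, Finset.mul_sum]
        exact Finset.sum_congr rfl fun j _ => by push_cast; ring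
      · rw [hB, Finset.sum_div, Finset.mul_sum]
        exact Finset.sum_congr rfl fun j _ => by push_cast; ring
    rw [h2, norm_mul, mul_pow, Complex.norm_real, Real.norm_eq_abs, sq_abs, div_pow, one_pow,
      Real.sq_sqrt hT0.le]
    split_ifs <;> rw [norm_div, div_pow, Complex.norm_real, Real.norm_eq_abs, sq_abs]
  have hsA : Real.sin θ ^ 2 * (‖A‖ ^ 2 / Real.sin θ ^ 2) = ‖A‖ ^ 2 := by
    by_cases h : Real.sin θ = 0
    · have : A = 0 := Finset.sum_eq_zero fun j _ => by simp only [sin_odd_mul_eq_zero h]; simp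
      simp [this]
    · field_simp
  have hcB : Real.cos θ ^ 2 * (‖B‖ ^ 2 / Real.cos θ ^ 2) = ‖B‖ ^ 2 := by
    by_cases h : Real.cos θ = 0
    · have : B = 0 := Finset.sum_eq_zero fun j _ => by simp only [cos_odd_mul_eq_zero h]; simp
      simp [this]
    · field_simp
  rw [Finset.sum_congr rfl fun t _ => h1 t, sum_ite_sin_cos p θ hθ]
  have e1 : ∑ j, c j * Complex.exp (((2 * (j : ℕ) + 1) * θ : ℝ) * Complex.I)
      = B + A * Complex.I := by
    rw [hA, hB, Finset.sum_mul, ← Finset.sum_add_distrib]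
    refine Finset.sum_congr rfl fun j _ => ?_
    rw [Complex.exp_mul_I, ← Complex.ofReal_cos, ← Complex.ofReal_sin]
    ring
  have e2 : ∑ j, c j * Complex.exp (((2 * (j : ℕ) + 1) * -θ : ℝ) * Complex.I)
      = B - A * Complex.I := by
    rw [hA, hB, Finset.sum_mul, ← Finset.sum_sub_distrib]
    refine Finset.sum_congr rfl fun j _ => ?_
    rw [Complex.exp_mul_I, ← Complex.ofReal_cos, ← Complex.ofReal_sin, mul_neg, Real.cos_neg,
      Real.sin_neg]
    push_cast
    ring
  rw [e1, e2]
  have hpar := parallelogram_law_with_norm ℝ B (A * Complex.I)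
  rw [norm_mul, Complex.norm_I, mul_one] at hpar
  have : T * (Real.sin θ ^ 2 * (1 / T * (‖A‖ ^ 2 / Real.sin θ ^ 2))
      + Real.cos θ ^ 2 * (1 / T * (‖B‖ ^ 2 / Real.cos θ ^ 2))) = ‖A‖ ^ 2 + ‖B‖ ^ 2 := by
    have hTT : (T : ℝ) * (1 / T) = 1 := mul_one_div_cancel hT0.ne'
    linear_combination hsA + hcB + (Real.sin θ ^ 2 * (‖A‖ ^ 2 / Real.sin θ ^ 2)
      + Real.cos θ ^ 2 * (‖B‖ ^ 2 / Real.cos θ ^ 2)) * hTT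
  rw [this]
  linarith

end GroverRotation

/-! ### Outcome distribution for a general window. -/

section Window

variable {Q : ℕ}

/-- The squared modulus of the trigonometric polynomial with coefficients `w`. -/
noncomputable def kernel (w : Fin Q → ℝ) (φ : ℝ) : ℝ :=
  ‖∑ j, (w j : ℂ) * Complex.exp (φ * Complex.I) ^ (j : ℕ)‖ ^ 2

theorem kernel_nonneg (w : Fin Q → ℝ) (φ : ℝ) : 0 ≤ kernel w φ := sq_nonneg _

/-- The Fourier row y shifts the phase 2θ by 2πy/Q; the remaining factor exp(iθ) has modulus one. -/
theorem norm_sq_sum_fourierMatrix (w : Fin Q → ℝ) (y : Fin Q) (θ : ℝ) :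
    ‖∑ j, fourierMatrix Q y j * (w j : ℂ) *
        Complex.exp (((2 * (j : ℕ) + 1) * θ : ℝ) * Complex.I)‖ ^ 2
      = kernel w (2 * θ - 2 * Real.pi * (y : ℕ) / Q) / Q := by
  have h : ∑ j, fourierMatrix Q y j * (w j : ℂ) *
        Complex.exp (((2 * (j : ℕ) + 1) * θ : ℝ) * Complex.I)
      = Complex.exp (θ * Complex.I) / (Real.sqrt Q : ℝ) * ∑ j, (w j : ℂ) *
        Complex.exp ((2 * θ - 2 * Real.pi * (y : ℕ) / Q : ℝ) * Complex.I) ^ (j : ℕ) := by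
    rw [Finset.mul_sum]
    refine Finset.sum_congr rfl fun j _ => ?_
    rw [← Complex.exp_nat_mul]
    simp only [fourierMatrix, Matrix.of_apply]
    have e : Complex.exp (-(2 * Real.pi * (y : ℕ) * (j : ℕ) / Q : ℝ) * Complex.I)
        * Complex.exp (((2 * (j : ℕ) + 1) * θ : ℝ) * Complex.I)
        = Complex.exp (θ * Complex.I) * Complex.exp ((j : ℕ) *
          ((2 * θ - 2 * Real.pi * (y : ℕ) / Q : ℝ) * Complex.I)) := by
      rw [← Complex.exp_add, ← Complex.exp_add]
      congr 1
      push_cast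
      ring
    linear_combination ((w j : ℂ) / (Real.sqrt Q : ℝ)) * e
  rw [h, norm_mul, mul_pow, norm_div, Complex.norm_exp_ofReal_mul_I, Complex.norm_real,
    Real.norm_eq_abs, div_pow, sq_abs, Real.sq_sqrt (Nat.cast_nonneg Q), kernel]
  ring

/-- Parseval's identity, from unitarity of the Fourier matrix. -/
theorem sum_kernel (hQ : 0 < Q) (w : Fin Q → ℝ) (θ : ℝ) :
    ∑ y : Fin Q, kernel w (2 * θ - 2 * Real.pi * (y : ℕ) / Q) = Q * ∑ j, w j ^ 2 := by
  have h := sum_norm_sq_mulVec _ (fourierMatrix_mem_unitaryGroup Q) fun j : Fin Q =>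
    (w j : ℂ) * Complex.exp (((2 * (j : ℕ) + 1) * θ : ℝ) * Complex.I)
  simp only [mulVec, dotProduct, ← mul_assoc, norm_sq_sum_fourierMatrix] at h
  rw [← Finset.sum_div, div_eq_iff (by positivity)] at h
  rw [h, mul_comm]
  congr 1
  refine Finset.sum_congr rfl fun j _ => ?_
  rw [norm_mul, Complex.norm_exp_ofReal_mul_I, mul_one, Complex.norm_real, Real.norm_eq_abs,
    sq_abs]

end Window

/-- Amplitude estimation with window `w`: the distribution of the outcome. -/
theorem exists_amplitude_estimation {N T : ℕ} (hN : 0 < N) (hT : 0 < T) (S R : Finset (Fin N))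
    (M Q : ℕ) (hQ : 0 < Q) (w : Fin Q → ℝ) (hw : ∑ j, w j ^ 2 = 1)
    (hsupp : ∀ j : Fin Q, M / 2 < j → w j = 0) (out : Fin Q → ℝ) :
    ∃ A : QueryAlgorithm N T M, ∀ (O : Finset (Fin N) → Fin T → Fin N) (θ : ℝ),
      ((Finset.univ.filter fun t => O S t ∈ R).card : ℝ) = T * Real.sin θ ^ 2 →
      ∀ (E : Set ℝ) [DecidablePred (· ∈ E)], A.prob O E = ∑ y : Fin Q, if out y ∈ E then
        (kernel w (2 * θ - 2 * Real.pi * (y : ℕ) / Q)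
          + kernel w (2 * -θ - 2 * Real.pi * (y : ℕ) / Q)) / (2 * Q) else 0 := by
  obtain ⟨A, hA⟩ := exists_grover_algorithm hN hT S R M Q hQ w hw hsupp out
  refine ⟨A, fun O θ hθ E _ => ?_⟩
  rw [hA O E]
  refine Finset.sum_congr rfl fun y _ => ?_
  congr 1
  have := sum_norm_sq_sum_grover hT (fun t => O S t ∈ R) θ hθ
    fun j => fourierMatrix Q y j * (w j : ℂ)
  rw [norm_sq_sum_fourierMatrix, norm_sq_sum_fourierMatrix] at this
  simp only [← mul_assoc]
  refine this.trans ?_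
  ring

/-! ### Windows from powers of the Dirichlet kernel. -/

section PowerWindow

open Polynomial in
/-- The polynomial `(1 + X + ⋯ + X ^ (m - 1)) ^ r`. -/
noncomputable def windowPoly (m r : ℕ) : ℝ[X] := (∑ i ∈ Finset.range m, X ^ i) ^ r

theorem natDegree_windowPoly_le (m r : ℕ) : (windowPoly m r).natDegree ≤ r * (m - 1) := by
  refine Polynomial.natDegree_pow_le.trans (Nat.mul_le_mul_left r ?_)
  refine Polynomial.natDegree_sum_le_of_forall_le _ _ fun i hi => ?_
  rw [Polynomial.natDegree_X_pow]
  have := Finset.mem_range.mp hi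
  omega

theorem sum_coeff_windowPoly_mul_pow {m r Q : ℕ} (hQ : r * (m - 1) < Q) (z : ℂ) :
    ∑ j : Fin Q, ((windowPoly m r).coeff j : ℂ) * z ^ (j : ℕ)
      = (∑ i ∈ Finset.range m, z ^ i) ^ r := by
  have h := Polynomial.aeval_eq_sum_range' ((natDegree_windowPoly_le m r).trans_lt hQ) z
  rw [Fin.sum_univ_eq_sum_range (fun j => ((windowPoly m r).coeff j : ℂ) * z ^ j)]
  simp only [Complex.real_smul] at h
  rw [← h]
  simp [windowPoly]

/-- The squared norm of the coefficients of `windowPoly m r`. -/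
noncomputable def windowNormSq (m r Q : ℕ) : ℝ := ∑ j : Fin Q, (windowPoly m r).coeff j ^ 2

/-- Cauchy–Schwarz: the coefficients sum to m^r (the value at 1), and at most r(m-1) + 1 ≤ rm of
them are nonzero. -/
theorem pow_le_mul_windowNormSq {m r Q : ℕ} (hm : 1 ≤ m) (hr : 1 ≤ r) (hQ : r * (m - 1) < Q) :
    (m : ℝ) ^ (2 * r) ≤ r * m * windowNormSq m r Q := by
  set K := r * (m - 1) + 1 with hK
  have h1 : ∑ j ∈ Finset.range K, (windowPoly m r).coeff j = (m : ℝ) ^ r := by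
    have h := Polynomial.aeval_eq_sum_range' ((natDegree_windowPoly_le m r).trans_lt
      (Nat.lt_succ_self _)) (1 : ℝ)
    simp only [one_pow, smul_eq_mul, mul_one] at h
    rw [hK, ← Nat.succ_eq_add_one, ← h]
    simp [windowPoly]
  have h2 := sq_sum_le_card_mul_sum_sq (s := Finset.range K) (f := (windowPoly m r).coeff)
  rw [h1, Finset.card_range, ← pow_mul, mul_comm r 2] at h2
  have h3 : ∑ j ∈ Finset.range K, (windowPoly m r).coeff j ^ 2 ≤ windowNormSq m r Q := by
    rw [windowNormSq, Fin.sum_univ_eq_sum_range (fun j => (windowPoly m r).coeff j ^ 2)]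
    exact Finset.sum_le_sum_of_subset_of_nonneg (Finset.range_subset_range.mpr (by omega))
      fun _ _ _ => sq_nonneg _
  have h4 : (K : ℝ) ≤ r * m := by
    have : K ≤ r * m := by
      obtain ⟨m, rfl⟩ := Nat.exists_eq_add_of_le' hm
      rw [hK, Nat.add_sub_cancel, mul_add]
      omega
    exact_mod_cast this
  refine h2.trans (mul_le_mul h4 h3 (Finset.sum_nonneg fun _ _ => sq_nonneg _) (by positivity))

theorem windowNormSq_pos {m r Q : ℕ} (hm : 1 ≤ m) (hr : 1 ≤ r) (hQ : r * (m - 1) < Q) :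
    0 < windowNormSq m r Q := by
  have h := pow_le_mul_windowNormSq hm hr hQ
  have h1 : (0 : ℝ) < (m : ℝ) ^ (2 * r) := by positivity
  have h2 : (0 : ℝ) < r * m := by positivity
  exact pos_of_mul_pos_right (h1.trans_le h) h2.le

/-- The unit vector of normalized coefficients of `windowPoly m r`. -/
noncomputable def powerWindow (m r Q : ℕ) (j : Fin Q) : ℝ :=
  (windowPoly m r).coeff j / Real.sqrt (windowNormSq m r Q)

theorem sum_powerWindow_sq {m r Q : ℕ} (hm : 1 ≤ m) (hr : 1 ≤ r) (hQ : r * (m - 1) < Q) :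
    ∑ j, powerWindow m r Q j ^ 2 = 1 := by
  have h := windowNormSq_pos hm hr hQ
  simp only [powerWindow, div_pow, Real.sq_sqrt h.le]
  rw [← Finset.sum_div]
  exact div_self h.ne'

theorem powerWindow_eq_zero {m r Q : ℕ} (j : Fin Q) (hj : r * (m - 1) < j) :
    powerWindow m r Q j = 0 := by
  rw [powerWindow, Polynomial.coeff_eq_zero_of_natDegree_lt
    ((natDegree_windowPoly_le m r).trans_lt hj), zero_div]

/-- The Dirichlet kernel `1 + z + ⋯ + z ^ (m - 1)` at `z = exp (iφ)`. -/
noncomputable def dirichletSum (m : ℕ) (φ : ℝ) : ℂ :=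
  ∑ i ∈ Finset.range m, Complex.exp (φ * Complex.I) ^ i

theorem kernel_powerWindow {m r Q : ℕ} (hQ : r * (m - 1) < Q) (φ : ℝ) :
    kernel (powerWindow m r Q) φ = ‖dirichletSum m φ‖ ^ (2 * r) / windowNormSq m r Q := by
  have h : ∑ j : Fin Q, (powerWindow m r Q j : ℂ) * Complex.exp (φ * Complex.I) ^ (j : ℕ)
      = dirichletSum m φ ^ r / (Real.sqrt (windowNormSq m r Q) : ℝ) := by
    rw [dirichletSum, ← sum_coeff_windowPoly_mul_pow hQ, Finset.sum_div]
    refine Finset.sum_congr rfl fun j _ => ?_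
    rw [powerWindow]
    push_cast
    ring
  have hn : 0 ≤ windowNormSq m r Q := Finset.sum_nonneg fun _ _ => sq_nonneg _
  rw [kernel, h, norm_div, norm_pow, div_pow, Complex.norm_real, Real.norm_eq_abs, sq_abs,
    Real.sq_sqrt hn, ← pow_mul, mul_comm r 2]

/-- Telescoping against exp(iφ) - 1, of modulus 2|sin(φ/2)|, leaves a difference of two unit
numbers. -/
theorem norm_dirichletSum_mul_abs_sin_le (m : ℕ) (φ : ℝ) :
    ‖dirichletSum m φ‖ * |Real.sin (φ / 2)| ≤ 1 := by
  have h1 : ‖dirichletSum m φ * (Complex.exp (φ * Complex.I) - 1)‖ ≤ 2 := by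
    rw [dirichletSum, geom_sum_mul]
    refine (norm_sub_le _ _).trans ?_
    rw [norm_pow, Complex.norm_exp_ofReal_mul_I]
    norm_num
  rw [norm_mul, mul_comm (φ : ℂ), Complex.norm_exp_I_mul_ofReal_sub_one, Real.norm_eq_abs, abs_mul,
    abs_two] at h1
  linarith

theorem half_le_norm_dirichletSum (m : ℕ) (φ : ℝ) (h : m * |φ| ≤ 1) :
    (m : ℝ) / 2 ≤ ‖dirichletSum m φ‖ := by
  refine le_trans ?_ (Complex.re_le_norm _)
  rw [dirichletSum, Complex.re_sum]
  have : ∀ i ∈ Finset.range m, (1 / 2 : ℝ) ≤ (Complex.exp (φ * Complex.I) ^ i).re := by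
    intro i hi
    have hi' : (i : ℝ) ≤ m := by exact_mod_cast (Finset.mem_range.mp hi).le
    have h1 : |(i : ℝ) * φ| ≤ 1 := by
      rw [abs_mul, Nat.abs_cast]
      exact (mul_le_mul_of_nonneg_right hi' (abs_nonneg _)).trans h
    have h2 : (Complex.exp (φ * Complex.I) ^ i).re = Real.cos (i * φ) := by
      rw [← Complex.exp_nat_mul, ← mul_assoc, ← Complex.ofReal_natCast, ← Complex.ofReal_mul,
        Complex.exp_ofReal_mul_I_re]
    rw [h2]
    have h3 := Real.one_sub_sq_div_two_le_cos (x := i * φ)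
    have h4 : ((i : ℝ) * φ) ^ 2 ≤ 1 := by
      rw [← sq_abs]
      exact pow_le_one₀ (abs_nonneg _) h1
    linarith
  refine le_trans (le_of_eq ?_) (Finset.sum_le_sum this)
  simp
  ring

theorem windowNormSq_one {m Q : ℕ} (hm : m ≤ Q) : windowNormSq m 1 Q = m := by
  have hc : ∀ j : ℕ, (windowPoly m 1).coeff j ^ 2 = if j < m then 1 else 0 := by
    intro j
    simp [windowPoly, Polynomial.coeff_X_pow]
  rw [windowNormSq, Fin.sum_univ_eq_sum_range (fun j => (windowPoly m 1).coeff j ^ 2)]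
  simp only [hc]
  rw [← Finset.sum_filter, Finset.sum_const, nsmul_eq_mul, mul_one]
  congr 1
  have : (Finset.range Q).filter (fun j => j < m) = Finset.range m := by
    ext j
    simp only [Finset.mem_filter, Finset.mem_range]
    omega
  rw [this, Finset.card_range]

/-- Parseval for the flat window r = 1. -/
theorem sum_norm_sq_dirichletSum {m Q : ℕ} (hm : 1 ≤ m) (hmQ : m ≤ Q) (θ : ℝ) :
    ∑ y : Fin Q, ‖dirichletSum m (2 * θ - 2 * Real.pi * (y : ℕ) / Q)‖ ^ 2 = Q * m := by
  have hQ : 0 < Q := by omega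
  have h1 := sum_kernel hQ (powerWindow m 1 Q) θ
  have hm0 : (m : ℝ) ≠ 0 := by positivity
  rw [sum_powerWindow_sq hm le_rfl (by omega)] at h1
  simp only [kernel_powerWindow (show 1 * (m - 1) < Q by omega), windowNormSq_one hmQ,
    mul_one] at h1
  rw [← Finset.sum_div, div_eq_iff hm0] at h1
  exact h1

/-- The outcomes far from the eigenphase have exponentially small weight. -/
theorem sum_kernel_powerWindow_far_le {m r Q : ℕ} (hm : 1 ≤ m) (hr : 1 ≤ r)
    (hQ : r * (m - 1) < Q) (θ : ℝ) :
    (∑ y : Fin Q, if 4 / m < |Real.sin (θ - Real.pi * (y : ℕ) / Q)| then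
      kernel (powerWindow m r Q) (2 * θ - 2 * Real.pi * (y : ℕ) / Q) else 0)
      ≤ Q * (r / 16 ^ (r - 1)) := by
  have hm0 : (0 : ℝ) < m := by positivity
  have hmQ : m ≤ Q := by
    have : m - 1 ≤ r * (m - 1) := Nat.le_mul_of_pos_left _ hr
    omega
  obtain ⟨s, rfl⟩ := Nat.exists_eq_add_of_le' hr
  have hn := windowNormSq_pos hm hr hQ
  -- Of the 2(s+1) Dirichlet factors, 2s are bounded by m/4 far from the peak; the last two are kept
  -- and summed exactly by Parseval, so no tail sum is estimated.
  have hterm : ∀ y : Fin Q, (if 4 / m < |Real.sin (θ - Real.pi * (y : ℕ) / Q)| then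
      kernel (powerWindow m (s + 1) Q) (2 * θ - 2 * Real.pi * (y : ℕ) / Q) else 0)
      ≤ (m / 4 : ℝ) ^ (2 * s) / windowNormSq m (s + 1) Q *
        ‖dirichletSum m (2 * θ - 2 * Real.pi * (y : ℕ) / Q)‖ ^ 2 := by
    intro y
    split_ifs with h
    · rw [kernel_powerWindow hQ]
      have h1 := norm_dirichletSum_mul_abs_sin_le m (2 * θ - 2 * Real.pi * (y : ℕ) / Q)
      have e : (2 * θ - 2 * Real.pi * (y : ℕ) / Q) / 2 = θ - Real.pi * (y : ℕ) / Q := by ring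
      rw [e] at h1
      have h2 : ‖dirichletSum m (2 * θ - 2 * Real.pi * (y : ℕ) / Q)‖ ≤ m / 4 := by
        have h3 : ‖dirichletSum m (2 * θ - 2 * Real.pi * (y : ℕ) / Q)‖ * (4 / m) ≤ 1 :=
          (mul_le_mul_of_nonneg_left h.le (norm_nonneg _)).trans h1
        rw [mul_div_assoc', div_le_iff₀ hm0] at h3
        linarith
      have h4 := pow_le_pow_left₀ (norm_nonneg _) h2 (2 * s)
      rw [mul_add, mul_one, pow_add, div_mul_eq_mul_div]
      gcongr
    · positivity
  refine (Finset.sum_le_sum fun y _ => hterm y).trans ?_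
  rw [← Finset.mul_sum, sum_norm_sq_dirichletSum hm hmQ, Nat.add_sub_cancel]
  have h5 := pow_le_mul_windowNormSq hm hr hQ
  rw [div_mul_eq_mul_div, div_le_iff₀ hn]
  have e1 : (m / 4 : ℝ) ^ (2 * s) * (Q * m) = Q * (m ^ (2 * (s + 1)) / m) / 16 ^ s := by
    rw [div_pow, pow_mul (4 : ℝ)]
    norm_num
    rw [mul_add, pow_add]
    field_simp
  have h6 : (m : ℝ) ^ (2 * (s + 1)) / m ≤ ((s + 1 : ℕ) : ℝ) * windowNormSq m (s + 1) Q := by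
    rw [div_le_iff₀ hm0]
    linarith
  rw [e1]
  calc Q * ((m : ℝ) ^ (2 * (s + 1)) / m) / 16 ^ s
      ≤ Q * (((s + 1 : ℕ) : ℝ) * windowNormSq m (s + 1) Q) / 16 ^ s := by gcongr
    _ = _ := by ring

theorem le_kernel_powerWindow_one {m Q : ℕ} (hm : 1 ≤ m) (hmQ : m ≤ Q) (φ : ℝ)
    (h : m * |φ| ≤ 1) : (m : ℝ) / 4 ≤ kernel (powerWindow m 1 Q) φ := by
  have hm0 : (0 : ℝ) < m := by positivity
  rw [kernel_powerWindow (by omega), windowNormSq_one hmQ, le_div_iff₀ hm0]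
  have := pow_le_pow_left₀ (by positivity) (half_le_norm_dirichletSum m φ h) 2
  calc (m : ℝ) / 4 * m = (m / 2) ^ 2 := by ring
    _ ≤ _ := this

end PowerWindow

/-! ### From angle concentration to the error bound, and the two ranges of δ. -/

section Estimation

theorem exists_angle {N T : ℕ} (hT : 0 < T) {D : Fin N → ℝ} {S : Finset (Fin N)}
    (hS : 0 < weight D S) {O : Finset (Fin N) → Fin T → Fin N} (hO : Represents D O)
    (R : Finset (Fin N)) :
    ∃ θ : ℝ, 0 ≤ θ ∧ θ ≤ Real.pi / 2 ∧ weight (condDist D S) R = Real.sin θ ^ 2 ∧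
      ((Finset.univ.filter fun t => O S t ∈ R).card : ℝ) = T * Real.sin θ ^ 2 := by
  have hT0 : (0 : ℝ) < T := by exact_mod_cast hT
  set k := (Finset.univ.filter fun t => O S t ∈ R).card with hk
  have hw : weight (condDist D S) R = k / T := by
    have h1 : k = ∑ i ∈ R, (Finset.univ.filter fun t => O S t = i).card := by
      have h2 := Finset.card_eq_sum_card_fiberwise (f := fun t => O S t) (t := R)
        (s := Finset.univ.filter fun t => O S t ∈ R) fun t ht => (Finset.mem_filter.mp ht).2
      refine h2.trans ?_
      refine Finset.sum_congr rfl fun i hi => ?_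
      congr 1
      ext t
      simp only [Finset.mem_filter, Finset.mem_univ, true_and, and_iff_right_iff_imp]
      rintro rfl
      exact hi
    rw [weight, Finset.sum_congr rfl fun i _ => hO S hS i, ← Finset.sum_div, h1]
    push_cast
    rfl
  have hkT : (k : ℝ) / T ≤ 1 := by
    rw [div_le_one hT0]
    have := Finset.card_filter_le (Finset.univ : Finset (Fin T)) fun t => O S t ∈ R
    rw [Finset.card_univ, Fintype.card_fin] at this
    exact_mod_cast this
  have hk0 : 0 ≤ (k : ℝ) / T := by positivity
  have hsin : Real.sin (Real.arcsin (Real.sqrt (k / T))) ^ 2 = k / T := by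
    rw [Real.sin_arcsin (by linarith [Real.sqrt_nonneg ((k : ℝ) / T)])
      (Real.sqrt_le_one.mpr hkT), Real.sq_sqrt hk0]
  refine ⟨Real.arcsin (Real.sqrt (k / T)), Real.arcsin_nonneg.mpr (Real.sqrt_nonneg _),
    Real.arcsin_le_pi_div_two _, ?_, ?_⟩
  · rw [hw, hsin]
  · rw [hsin]
    field_simp

/-- With u = θ - x the difference is -sin u · sin(2θ - u). Expanding the second factor keeps a
factor sin θ in the linear term, the source of √D_S(R) in the query bound. -/
theorem abs_sin_sq_sub_sin_sq_le (x θ σ : ℝ) (h : |Real.sin (θ - x)| ≤ σ) :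
    |Real.sin x ^ 2 - Real.sin θ ^ 2| ≤ 2 * |Real.sin θ| * σ + σ ^ 2 := by
  set u := θ - x with hu
  have hx : x = θ - u := by ring
  have e : Real.sin x ^ 2 - Real.sin θ ^ 2
      = Real.sin u * (Real.sin u * Real.cos (2 * θ) - 2 * Real.sin θ * Real.cos θ * Real.cos u) := by
    rw [hx, Real.sin_sub, Real.cos_two_mul]
    have h1 := Real.sin_sq_add_cos_sq θ
    have h2 := Real.sin_sq_add_cos_sq u
    linear_combination (-Real.sin u ^ 2) * h1 + (Real.sin θ ^ 2) * h2
  have h0 := (abs_nonneg _).trans h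
  have h3 : |Real.sin u * Real.cos (2 * θ) - 2 * Real.sin θ * Real.cos θ * Real.cos u|
      ≤ σ + 2 * |Real.sin θ| := by
    refine (abs_sub _ _).trans (add_le_add ?_ ?_)
    · rw [abs_mul]
      exact (mul_le_of_le_one_right (abs_nonneg _) (Real.abs_cos_le_one _)).trans h
    · rw [abs_mul, abs_mul, abs_mul, abs_two]
      refine (mul_le_of_le_one_right (by positivity) (Real.abs_cos_le_one _)).trans ?_
      exact mul_le_of_le_one_right (by positivity) (Real.abs_cos_le_one _)
  rw [e, abs_mul]
  calc _ ≤ σ * (σ + 2 * |Real.sin θ|) := mul_le_mul h h3 (abs_nonneg _) h0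
    _ = _ := by ring

/-- The accuracy `σ` of the sine of the angle suffices for the accuracy `ε` of its square. -/
theorem error_le_of_query_bound {s σ ε K M : ℝ} (hs : 0 ≤ s) (hσ : 0 ≤ σ) (hε : 0 < ε)
    (hM : 0 < M) (hK : 3 * σ * M ≤ K) (h : K * max (s / ε) (1 / Real.sqrt ε) ≤ M) :
    2 * s * σ + σ ^ 2 ≤ ε := by
  have hK0 : 0 ≤ K := le_trans (by positivity) hK
  have h1 : K * s ≤ M * ε := by
    have := (mul_le_mul_of_nonneg_left (le_max_left (s / ε) (1 / Real.sqrt ε)) hK0).trans h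
    rwa [mul_div_assoc', div_le_iff₀ hε] at this
  have h2 : K ≤ M * Real.sqrt ε := by
    have := (mul_le_mul_of_nonneg_left (le_max_right (s / ε) (1 / Real.sqrt ε)) hK0).trans h
    rwa [mul_one_div, div_le_iff₀ (Real.sqrt_pos.mpr hε)] at this
  have h3 : K ^ 2 ≤ M ^ 2 * ε := by
    have := pow_le_pow_left₀ hK0 h2 2
    rwa [mul_pow, Real.sq_sqrt hε.le] at this
  have h4 : (3 * σ * M) ^ 2 ≤ K ^ 2 := pow_le_pow_left₀ (by positivity) hK 2
  have h5 : s * M * (3 * σ * M) ≤ s * M * K := mul_le_mul_of_nonneg_left hK (by positivity)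
  have h6 : M * (K * s) ≤ M * (M * ε) := mul_le_mul_of_nonneg_left h1 hM.le
  -- The two terms are at most 2/3 and 1/9 of M²ε.
  have h7 : M ^ 2 * (2 * s * σ + σ ^ 2) ≤ M ^ 2 * ε := by
    nlinarith
  exact le_of_mul_le_mul_left h7 (by positivity)

/-- A unit window concentrated near zero makes every set of outcomes that contains all outcomes
near the eigenphases likely. -/
theorem one_sub_le_sum_of_far {Q : ℕ} (hQ : 0 < Q) {w : Fin Q → ℝ} (hw : ∑ j, w j ^ 2 = 1)
    (θ σ η : ℝ)
    (hfar : ∀ θ : ℝ, (∑ y : Fin Q, if σ < |Real.sin (θ - Real.pi * (y : ℕ) / Q)| then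
      kernel w (2 * θ - 2 * Real.pi * (y : ℕ) / Q) else 0) ≤ Q * η)
    (p : Fin Q → Prop) [DecidablePred p]
    (hp : ∀ y, ¬ p y → σ < |Real.sin (θ - Real.pi * (y : ℕ) / Q)| ∧
      σ < |Real.sin (-θ - Real.pi * (y : ℕ) / Q)|) :
    1 - η ≤ ∑ y : Fin Q, if p y then (kernel w (2 * θ - 2 * Real.pi * (y : ℕ) / Q)
          + kernel w (2 * -θ - 2 * Real.pi * (y : ℕ) / Q)) / (2 * Q) else 0 := by
  have hQ0 : (0 : ℝ) < Q := by exact_mod_cast hQ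
  have h1 := sum_kernel hQ w θ
  have h2 := sum_kernel hQ w (-θ)
  rw [hw, mul_one] at h1 h2
  have h3 := hfar θ
  have h4 := hfar (-θ)
  have hterm : ∀ y : Fin Q, kernel w (2 * θ - 2 * Real.pi * (y : ℕ) / Q)
      + kernel w (2 * -θ - 2 * Real.pi * (y : ℕ) / Q)
      - (if σ < |Real.sin (θ - Real.pi * (y : ℕ) / Q)| then
          kernel w (2 * θ - 2 * Real.pi * (y : ℕ) / Q) else 0)
      - (if σ < |Real.sin (-θ - Real.pi * (y : ℕ) / Q)| then
          kernel w (2 * -θ - 2 * Real.pi * (y : ℕ) / Q) else 0)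
      ≤ (2 * Q) * if p y then (kernel w (2 * θ - 2 * Real.pi * (y : ℕ) / Q)
          + kernel w (2 * -θ - 2 * Real.pi * (y : ℕ) / Q)) / (2 * Q) else 0 := by
    intro y
    have k1 := kernel_nonneg w (2 * θ - 2 * Real.pi * (y : ℕ) / Q)
    have k2 := kernel_nonneg w (2 * -θ - 2 * Real.pi * (y : ℕ) / Q)
    by_cases hy : p y
    · rw [if_pos hy, mul_div_cancel₀ _ (by positivity)]
      split_ifs <;> linarith
    -- A rejected outcome is far from both eigenphases, so its whole mass is removed by the two far
    -- sums.
    · rw [if_neg hy, if_pos (hp y hy).1, if_pos (hp y hy).2]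
      linarith
  have h5 := Finset.sum_le_sum fun (y : Fin Q) (_ : y ∈ Finset.univ) => hterm y
  rw [Finset.sum_sub_distrib, Finset.sum_sub_distrib, Finset.sum_add_distrib, h1, h2,
    ← Finset.mul_sum] at h5
  refine le_of_mul_le_mul_left (a := 2 * (Q : ℝ)) ?_ (by positivity)
  refine le_trans ?_ h5
  linarith

/-- Split 16 = 2 · 8: the factor 2^s absorbs s + 1, and 8^s ≥ e^s ≥ 1/δ. -/
theorem succ_div_sixteen_pow_le {δ : ℝ} (hδ : 0 < δ) (s : ℕ) (hs : Real.log (1 / δ) ≤ s) :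
    ((s + 1 : ℕ) : ℝ) / 16 ^ s ≤ δ := by
  have h1 : ((s + 1 : ℕ) : ℝ) ≤ 2 ^ s := by exact_mod_cast Nat.lt_two_pow_self
  have h2 : 1 / δ ≤ 8 ^ s := by
    rw [Real.log_le_iff_le_exp (by positivity)] at hs
    refine hs.trans ?_
    rw [← Real.exp_one_pow]
    exact pow_le_pow_left₀ (Real.exp_pos _).le (by linarith [Real.exp_one_lt_d9]) s
  rw [div_le_iff₀ (by positivity)]
  rw [div_le_iff₀ hδ] at h2
  have e : (16 : ℝ) ^ s = 8 ^ s * 2 ^ s := by rw [← mul_pow]; norm_num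
  calc ((s + 1 : ℕ) : ℝ) ≤ 1 * 2 ^ s := by rw [one_mul]; exact h1
    _ ≤ (8 ^ s * δ) * 2 ^ s := by gcongr
    _ = δ * 16 ^ s := by rw [e]; ring

/-- The number of outcomes in an interval. -/
theorem le_card_filter_interval {Q : ℕ} (x ℓ : ℝ) (hx : 0 ≤ x) (hQ : x + ℓ < Q) :
    ℓ - 1 ≤ ((Finset.univ.filter fun y : Fin Q => x ≤ (y : ℕ) ∧ ((y : ℕ) : ℝ) ≤ x + ℓ).card : ℝ)
      := by
  rcases lt_or_ge ℓ 0 with hℓ | hℓ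
  · exact le_trans (by linarith) (Nat.cast_nonneg _)
  have hle : ∀ i : Fin ⌊ℓ⌋₊, ((⌈x⌉₊ + i : ℕ) : ℝ) ≤ x + ℓ := by
    intro i
    have h1 := Nat.ceil_lt_add_one hx
    have h2 : ((i : ℕ) : ℝ) + 1 ≤ ⌊ℓ⌋₊ := by exact_mod_cast i.2
    have h3 := Nat.floor_le hℓ
    push_cast
    linarith
  have hcard : ⌊ℓ⌋₊ ≤ (Finset.univ.filter fun y : Fin Q =>
      x ≤ (y : ℕ) ∧ ((y : ℕ) : ℝ) ≤ x + ℓ).card := by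
    have h := Finset.card_le_card_of_injOn (s := (Finset.univ : Finset (Fin ⌊ℓ⌋₊)))
      (t := Finset.univ.filter fun y : Fin Q => x ≤ (y : ℕ) ∧ ((y : ℕ) : ℝ) ≤ x + ℓ)
      (fun i => (⟨⌈x⌉₊ + i, by exact_mod_cast (hle i).trans_lt hQ⟩ : Fin Q)) ?_ ?_
    · rwa [Finset.card_univ, Fintype.card_fin] at h
    · intro i _
      simp only [Finset.coe_filter, Finset.mem_univ, true_and, Set.mem_ofPred_eq]
      refine ⟨?_, hle i⟩
      push_cast
      linarith [Nat.le_ceil x, (Nat.cast_nonneg i : (0 : ℝ) ≤ (i : ℕ))]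
    · intro i _ j _ hij
      simp only [Fin.mk.injEq] at hij
      exact Fin.ext (by omega)
  have h1 := Nat.lt_floor_add_one ℓ
  have h2 : (⌊ℓ⌋₊ : ℝ) ≤ _ := Nat.cast_le.mpr hcard
  linarith

/-- Outcomes close to the eigenphase are likely at the rate given by the density of the
distribution. -/
theorem le_sum_of_near {m Q : ℕ} (hm : 1 ≤ m) (hmQ : m ≤ Q) {θ Δ : ℝ} (hθ : 0 ≤ θ)
    (hθ' : θ ≤ Real.pi / 2) (hΔm : 2 * m * Δ ≤ 1)
    (hQΔ : 2 * Real.pi ≤ Q * Δ) (p : Fin Q → Prop) [DecidablePred p]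
    (hp : ∀ y : Fin Q, |Real.sin (θ - Real.pi * (y : ℕ) / Q)| ≤ Δ → p y) :
    m * Δ / (16 * Real.pi) ≤ ∑ y : Fin Q, if p y then
      (kernel (powerWindow m 1 Q) (2 * θ - 2 * Real.pi * (y : ℕ) / Q)
        + kernel (powerWindow m 1 Q) (2 * -θ - 2 * Real.pi * (y : ℕ) / Q)) / (2 * Q) else 0 := by
  have hπ := Real.pi_pos
  have hm1 : (1 : ℝ) ≤ m := by exact_mod_cast hm
  have hQ0 : (0 : ℝ) < Q := by exact_mod_cast (show 0 < Q by omega)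
  have hΔ : 0 < Δ := by
    by_contra h
    have : Q * Δ ≤ 0 := mul_nonpos_of_nonneg_of_nonpos hQ0.le (not_lt.mp h)
    linarith
  have hΔ1 : Δ ≤ 1 / 2 := by nlinarith
  -- Outcomes in [x, x + ℓ] have angle πy/Q in [θ, θ + Δ]. This interval stays below π, so there is
  -- no wrap-around, and the eigenphase at θ alone gives enough mass.
  set x : ℝ := Q * θ / Real.pi with hx
  set ℓ : ℝ := Q * Δ / Real.pi with hℓ
  have hx0 : 0 ≤ x := by positivity
  have hxQ : x + ℓ < Q := by
    rw [hx, hℓ, ← add_div, ← mul_add, div_lt_iff₀ hπ]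
    exact mul_lt_mul_of_pos_left (by linarith [Real.pi_gt_three]) hQ0
  have hcard := le_card_filter_interval x ℓ hx0 hxQ
  set G := Finset.univ.filter fun y : Fin Q => x ≤ (y : ℕ) ∧ ((y : ℕ) : ℝ) ≤ x + ℓ with hG
  have hnn : ∀ y : Fin Q, 0 ≤ (kernel (powerWindow m 1 Q) (2 * θ - 2 * Real.pi * (y : ℕ) / Q)
      + kernel (powerWindow m 1 Q) (2 * -θ - 2 * Real.pi * (y : ℕ) / Q)) / (2 * Q) := fun y =>
    div_nonneg (add_nonneg (kernel_nonneg _ _) (kernel_nonneg _ _)) (by positivity)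
  have hsum : ∑ y ∈ G, (m / 4 / (2 * Q) : ℝ) ≤ ∑ y : Fin Q, if p y then
      (kernel (powerWindow m 1 Q) (2 * θ - 2 * Real.pi * (y : ℕ) / Q)
        + kernel (powerWindow m 1 Q) (2 * -θ - 2 * Real.pi * (y : ℕ) / Q)) / (2 * Q) else 0 := by
    refine le_trans (Finset.sum_le_sum fun y hy => ?_)
      (Finset.sum_le_sum_of_subset_of_nonneg (Finset.subset_univ G) fun y _ _ => ?_)
    · obtain ⟨h1, h2⟩ := (Finset.mem_filter.mp hy).2
      rw [hx, div_le_iff₀ hπ] at h1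
      rw [hx, hℓ, ← add_div, ← mul_add, le_div_iff₀ hπ] at h2
      have h3 : θ ≤ Real.pi * (y : ℕ) / Q := by rw [le_div_iff₀ hQ0]; linarith
      have h4 : Real.pi * (y : ℕ) / Q ≤ θ + Δ := by rw [div_le_iff₀ hQ0]; linarith
      have h5 : |θ - Real.pi * (y : ℕ) / Q| ≤ Δ := abs_le.mpr ⟨by linarith, by linarith⟩
      rw [if_pos (hp y (Real.abs_sin_le_abs.trans h5))]
      have h6 : (m : ℝ) * |2 * θ - 2 * Real.pi * (y : ℕ) / Q| ≤ 1 := by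
        have e : 2 * θ - 2 * Real.pi * (y : ℕ) / Q = 2 * (θ - Real.pi * (y : ℕ) / Q) := by ring
        rw [e, abs_mul, abs_two]
        nlinarith
      have h7 := le_kernel_powerWindow_one hm hmQ _ h6
      have h8 := kernel_nonneg (powerWindow m 1 Q) (2 * -θ - 2 * Real.pi * (y : ℕ) / Q)
      gcongr
      linarith
    · split_ifs
      · exact hnn y
      · exact le_rfl
  refine le_trans ?_ hsum
  rw [Finset.sum_const, nsmul_eq_mul]
  -- The grid is fine enough for ℓ ≥ 2, hence ℓ - 1 ≥ ℓ/2.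
  have h9 : ℓ / 2 ≤ (G.card : ℝ) := by
    have : 2 ≤ ℓ := by rw [hℓ, le_div_iff₀ hπ]; exact hQΔ
    linarith
  calc m * Δ / (16 * Real.pi) = ℓ / 2 * (m / 4 / (2 * Q)) := by rw [hℓ]; field_simp; norm_num
    _ ≤ _ := by gcongr

/-- Amplitude estimation when high success probability is required. -/
theorem exists_algorithm_of_le_log {N T : ℕ} (hN : 0 < N) (hT : 0 < T) (S R : Finset (Fin N))
    (M : ℕ) {δ : ℝ} (hδ : 0 < δ) (hlog : 1 / (32 * Real.pi) ≤ Real.log (1 / δ)) :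
    ∃ A : QueryAlgorithm N T M, ∀ (O : Finset (Fin N) → Fin T → Fin N) (θ : ℝ),
      0 ≤ θ → θ ≤ Real.pi / 2 →
      ((Finset.univ.filter fun t => O S t ∈ R).card : ℝ) = T * Real.sin θ ^ 2 →
      ∀ ε : ℝ, 0 < ε → 5000 * Real.log (1 / δ) *
        max (Real.sin θ / ε) (1 / Real.sqrt ε) ≤ M →
      1 - δ ≤ A.prob O {x : ℝ | |x - Real.sin θ ^ 2| ≤ ε} := by
  classical
  have hπ := Real.pi_pos
  have hπ4 := Real.pi_lt_d2
  set L := Real.log (1 / δ) with hL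
  have hL0 : 0 < L := lt_of_lt_of_le (by positivity) hlog
  obtain ⟨s, hs⟩ : ∃ s, s = ⌈L⌉₊ := ⟨_, rfl⟩
  -- The largest m for which the window degree (s+1)(m-1) fits into the M/2 available iterations.
  obtain ⟨m, hm⟩ : ∃ m, m = M / 2 / (s + 1) + 1 := ⟨_, rfl⟩
  have hm1 : 1 ≤ m := hm ▸ Nat.le_add_left 1 _
  have hdeg : (s + 1) * (m - 1) ≤ M / 2 := by
    rw [hm, Nat.add_sub_cancel]
    exact Nat.mul_div_le _ _
  have hQ : (s + 1) * (m - 1) < M / 2 + 1 := Nat.lt_succ_of_le hdeg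
  have hw := sum_powerWindow_sq hm1 (Nat.le_add_left 1 s) hQ
  obtain ⟨A, hA⟩ := exists_amplitude_estimation hN hT S R M (M / 2 + 1) (Nat.succ_pos _)
    (powerWindow m (s + 1) (M / 2 + 1)) hw
    (fun j hj => powerWindow_eq_zero j (hdeg.trans_lt hj))
    (fun y => Real.sin (Real.pi * (y : ℕ) / (M / 2 + 1 : ℕ)) ^ 2)
  refine ⟨A, fun O θ hθ hθ' hcard ε hε hbound => ?_⟩
  rw [hA O θ hcard]
  have hsin : 0 ≤ Real.sin θ := Real.sin_nonneg_of_nonneg_of_le_pi hθ (by linarith)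
  have hm0 : (0 : ℝ) < m := by exact_mod_cast hm1
  have hM0 : (0 : ℝ) < M := lt_of_lt_of_le
    (mul_pos (by positivity) (lt_max_of_lt_right (by positivity))) hbound
  have hMm : (M : ℝ) ≤ 2 * ((s + 1) * m) := by
    have h1 : M / 2 < (s + 1) * m := by
      rw [hm]
      exact Nat.lt_mul_div_succ _ (Nat.succ_pos s)
    have h2 : M ≤ 2 * ((s + 1) * m) := by omega
    exact_mod_cast h2
  have hsL : (s : ℝ) < L + 1 := by rw [hs]; exact Nat.ceil_lt_add_one hL0.le
  -- Here M ≤ 2(s+1)m gives 24(s+1), and L ≥ 1/(32π) gives s + 1 ≤ 203L; 24 · 203 = 4872 explains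
  -- the constant.
  have hprec : 3 * (4 / m) * (M : ℝ) ≤ 5000 * L := by
    have h1 : (1 : ℝ) ≤ 101 * L := by
      rw [div_le_iff₀ (by positivity)] at hlog
      nlinarith
    have h2 : ((s : ℝ) + 1) ≤ 203 * L := by linarith
    have h3 : 3 * (4 / m) * (M : ℝ) ≤ 3 * (4 / m) * (2 * ((s + 1) * m)) := by gcongr
    refine h3.trans ?_
    have h4 : 3 * (4 / (m : ℝ)) * (2 * ((s + 1) * m)) = 24 * (s + 1) := by field_simp; norm_num
    rw [h4]
    linarith
  have herr := error_le_of_query_bound hsin (by positivity : (0 : ℝ) ≤ 4 / m) hε hM0 hprec hbound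
  have hη : ((s + 1 : ℕ) : ℝ) / 16 ^ s ≤ δ :=
    succ_div_sixteen_pow_le hδ s (by rw [← hL, hs]; exact Nat.le_ceil L)
  refine le_trans (by linarith : 1 - δ ≤ 1 - ((s + 1 : ℕ) : ℝ) / 16 ^ s) ?_
  refine one_sub_le_sum_of_far (Nat.succ_pos _) hw θ (4 / m) _
    (fun θ => sum_kernel_powerWindow_far_le hm1 (Nat.le_add_left 1 s) hQ θ) _ fun y hy => ?_
  simp only [Set.mem_ofPred_eq] at hy
  constructor
  · by_contra h
    have := abs_sin_sq_sub_sin_sq_le _ _ _ (not_lt.mp h)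
    rw [abs_of_nonneg hsin] at this
    exact hy (this.trans herr)
  · by_contra h
    have := abs_sin_sq_sub_sin_sq_le _ _ _ (not_lt.mp h)
    rw [Real.sin_neg, abs_neg, neg_sq, abs_of_nonneg hsin] at this
    exact hy (this.trans herr)

/-- Amplitude estimation when only low success probability is required. -/
theorem exists_algorithm_of_log_le {N T : ℕ} (hN : 0 < N) (hT : 0 < T) (S R : Finset (Fin N))
    (M : ℕ) {δ : ℝ} (hδ : 0 < δ) (hδ' : δ ≤ 1) (hlog : Real.log (1 / δ) ≤ 1 / (32 * Real.pi)) :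
    ∃ A : QueryAlgorithm N T M, ∀ (O : Finset (Fin N) → Fin T → Fin N) (θ : ℝ),
      0 ≤ θ → θ ≤ Real.pi / 2 →
      ((Finset.univ.filter fun t => O S t ∈ R).card : ℝ) = T * Real.sin θ ^ 2 →
      ∀ ε : ℝ, 0 < ε → 5000 * Real.log (1 / δ) *
        max (Real.sin θ / ε) (1 / Real.sqrt ε) ≤ M →
      1 - δ ≤ A.prob O {x : ℝ | |x - Real.sin θ ^ 2| ≤ ε} := by
  classical
  have hπ := Real.pi_pos
  have hπ4 := Real.pi_lt_d2
  set L := Real.log (1 / δ) with hL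
  have hLδ : 1 - δ ≤ L := by
    rw [hL, one_div, Real.log_inv]
    linarith [Real.log_le_sub_one_of_pos hδ]
  obtain ⟨m, hm⟩ : ∃ m, m = M / 2 + 1 := ⟨_, rfl⟩
  have hm1 : 1 ≤ m := by omega
  have hm0 : (0 : ℝ) < m := by exact_mod_cast hm1
  -- Makes the guaranteed mass mΔ/(16π) equal to L ≥ 1 - δ. The threshold L ≤ 1/(32π) is exactly 2mΔ
  -- ≤ 1.
  set Δ : ℝ := 16 * Real.pi * L / m with hΔ
  -- The workspace may exceed the window's support at no query cost, which makes the outcome grid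
  -- finer than Δ. If L = 0, the quotient is 0 by default and Q = m is still positive.
  obtain ⟨Q, hQ⟩ : ∃ Q, Q = ⌈2 * Real.pi / Δ⌉₊ + m := ⟨_, rfl⟩
  have hmQ : m ≤ Q := by omega
  obtain ⟨A, hA⟩ := exists_amplitude_estimation hN hT S R M Q (by omega)
    (powerWindow m 1 Q) (sum_powerWindow_sq hm1 le_rfl (by omega))
    (fun j hj => powerWindow_eq_zero j (by omega))
    (fun y => Real.sin (Real.pi * (y : ℕ) / Q) ^ 2)
  refine ⟨A, fun O θ hθ hθ' hcard ε hε hbound => ?_⟩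
  -- For L = 0 nothing is to be shown, as 1 - δ ≤ 0; otherwise the query bound forces M > 0.
  rcases (show 0 ≤ L by linarith).eq_or_lt with hL0 | hL0
  · refine le_trans (by linarith : 1 - δ ≤ 0) (Finset.sum_nonneg fun b _ => ?_)
    split_ifs
    · exact sq_nonneg _
    · exact le_rfl
  rw [hA O θ hcard]
  have hsin : 0 ≤ Real.sin θ := Real.sin_nonneg_of_nonneg_of_le_pi hθ (by linarith)
  have hM0 : (0 : ℝ) < M := lt_of_lt_of_le
    (mul_pos (by positivity) (lt_max_of_lt_right (by positivity))) hbound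
  have hMm : (M : ℝ) ≤ 2 * m := by exact_mod_cast (show M ≤ 2 * m by omega)
  have hΔ0 : 0 < Δ := by positivity
  have hmΔ : m * Δ = 16 * Real.pi * L := by rw [hΔ]; field_simp
  have hprec : 3 * Δ * (M : ℝ) ≤ 5000 * L := by
    calc 3 * Δ * (M : ℝ) ≤ 3 * Δ * (2 * m) := by gcongr
      _ = 96 * Real.pi * L := by linear_combination 6 * hmΔ
      _ ≤ 5000 * L := by gcongr; linarith
  have herr := error_le_of_query_bound hsin hΔ0.le hε hM0 hprec hbound
  have hΔm : 2 * m * Δ ≤ 1 := by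
    rw [le_div_iff₀ (by positivity)] at hlog
    linarith
  have hQΔ : 2 * Real.pi ≤ Q * Δ := by
    rw [← div_le_iff₀ hΔ0]
    refine (Nat.le_ceil _).trans ?_
    exact_mod_cast (show ⌈2 * Real.pi / Δ⌉₊ ≤ Q by omega)
  have hmain : m * Δ / (16 * Real.pi) = L := by rw [hmΔ]; field_simp
  refine hLδ.trans (hmain ▸ le_sum_of_near hm1 hmQ hθ hθ' hΔm hQΔ _ fun y hy => ?_)
  have := abs_sin_sq_sub_sin_sq_le _ _ _ hy
  rw [abs_of_nonneg hsin] at this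
  exact this.trans herr

end Estimation

end QCond

theorem mainTheorem9 :
    ∃ c : ℝ, 0 < c ∧
      ∀ (N T : ℕ), 0 < N → 0 < T →
      ∀ (S R : Finset (Fin N)), R ⊆ S →
      ∀ (M : ℕ) (δ : ℝ), 0 < δ → δ ≤ 1 →
        ∃ A : QCond.QueryAlgorithm N T M,
          ∀ (D : Fin N → ℝ), D ∈ stdSimplex ℝ (Fin N) → 0 < QCond.weight D S →
          ∀ (O : Finset (Fin N) → Fin T → Fin N), QCond.Represents D O →
          ∀ ε : ℝ, 0 < ε →
            c * Real.log (1 / δ) *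
                max (Real.sqrt (QCond.weight (QCond.condDist D S) R) / ε) (1 / Real.sqrt ε)
              ≤ (M : ℝ) →
            1 - δ ≤ A.prob O {x : ℝ | |x - QCond.weight (QCond.condDist D S) R| ≤ ε} := by
  refine ⟨5000, by norm_num, fun N T hN hT S R _ M δ hδ hδ' => ?_⟩
  obtain ⟨A, hA⟩ : ∃ A : QCond.QueryAlgorithm N T M,
      ∀ (O : Finset (Fin N) → Fin T → Fin N) (θ : ℝ), 0 ≤ θ → θ ≤ Real.pi / 2 →
      ((Finset.univ.filter fun t => O S t ∈ R).card : ℝ) = T * Real.sin θ ^ 2 →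
      ∀ ε : ℝ, 0 < ε → 5000 * Real.log (1 / δ) *
        max (Real.sin θ / ε) (1 / Real.sqrt ε) ≤ M →
      1 - δ ≤ A.prob O {x : ℝ | |x - Real.sin θ ^ 2| ≤ ε} := by
    rcases le_total (1 / (32 * Real.pi)) (Real.log (1 / δ)) with h | h
    · exact QCond.exists_algorithm_of_le_log hN hT S R M hδ h
    · exact QCond.exists_algorithm_of_log_le hN hT S R M hδ hδ' h
  refine ⟨A, fun D _ hS O hO ε hε hbound => ?_⟩
  obtain ⟨θ, hθ, hθ', hw, hcard⟩ := QCond.exists_angle hT hS hO R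
  rw [hw] at hbound ⊢
  rw [Real.sqrt_sq (Real.sin_nonneg_of_nonneg_of_le_pi hθ (by linarith [Real.pi_pos]))] at hbound
  exact hA O θ hθ hθ' hcard ε hε hbound
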